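/- All graphs are finite and simple. An EPT representation of a graph $G$ consists of a (finite) host tree $T$ and a family $(P_v)_{v\in V(G)}$ of paths of $T$ such that two distinct vertices $v,w$ of $G$ are adjacent if and only if $E(P_v)\cap E(P_w)\neq\emptyset$. The representation is Helly if the family $(E(P_v))_{v\in V(G)}$ has the Helly property: every nonempty pairwise intersecting subfamily has nonempty total intersection. $G$ is a Helly EPT graph if it has a Helly EPT representation, and $G$ belongs to Helly $[h,2,2]$ if it has a Helly EPT representation on a host tree of maximum degree $h$. A clique is an inclusion-maximal set of pairwise adjacent vertices. Gates are the graphs obtained (up to isomorphism) as follows: every chordless cycle $C_n$ with $n\ge 4$ is a gate; if $H$ is a gate, $C$ and $C'$ are disjoint cliques of $H$, and $(v_1,\dots,v_l)$ with $l\ge 2$ is a chordless path disjoint from $H$, then the union of $H$ and the path, plus all edges between $v_1$ and the vertices of $C$ and all edges between $v_l$ and the vertices of $C'$, is a gate; there are no other gates. A $k$-gate is a gate with exactly $k$ cliques. Theorem. Let $G$ be a Helly EPT graph and let $h\ge 3$ be an integer. Then $G$ does not belong to Helly $[h,2,2]$ if and only if there is an integer $k>h$ such that $G$ has a $k$-gate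 as an induced subgraph. -/

import Mathlib

universe u v

/-- The Helly property of a set family: every nonempty pairwise intersecting subfamily has
nonempty total intersection. -/
def HellyProperty {ι : Type u} {α : Type v} (S : ι → Set α) : Prop :=
  ∀ I : Set ι, I.Nonempty → (I.Pairwise fun i j => (S i ∩ S j).Nonempty) →
    (⋂ i ∈ I, S i).Nonempty

/-- An EPT representation of `G` on the host graph `T` (used for trees `T`): a path `P v` of `T`
for each vertex `v` of `G`, such that two distinct vertices of `G` are adjacent if and only if
their paths share an edge of `T`. -/
structure EPTRepresentation {V : Type u} {W : Type v} (G : SimpleGraph V) (T : SimpleGraph W) where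
  /-- One end of the path of a vertex. -/
  src : V → W
  /-- The other end of the path of a vertex. -/
  tgt : V → W
  /-- The path of a vertex. -/
  path : ∀ x : V, T.Path (src x) (tgt x)
  adj_iff : ∀ x y : V, x ≠ y →
    (G.Adj x y ↔ ((path x).1.edgeSet ∩ (path y).1.edgeSet).Nonempty)

/-- The family of the edge sets of the paths has the Helly property. -/
def EPTRepresentation.IsHelly {V : Type u} {W : Type v} {G : SimpleGraph V} {T : SimpleGraph W}
    (R : EPTRepresentation G T) : Prop :=
  HellyProperty fun x : V => (R.path x).1.edgeSet

/-- `G` is a Helly EPT graph: it has a Helly EPT representation on some finite host tree. -/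
def IsHellyEPT {V : Type u} (G : SimpleGraph V) : Prop :=
  ∃ (W : Type) (_ : Fintype W) (T : SimpleGraph W),
    T.IsTree ∧ ∃ R : EPTRepresentation G T, R.IsHelly

open Classical in
/-- `G` belongs to Helly `[h,2,2]`: it has a Helly EPT representation on some finite host tree
of maximum degree `h`. -/
def IsHellyEPTOfMaxDegree {V : Type u} (G : SimpleGraph V) (h : ℕ) : Prop :=
  ∃ (W : Type) (_ : Fintype W) (T : SimpleGraph W),
    T.IsTree ∧ T.maxDegree = h ∧ ∃ R : EPTRepresentation G T, R.IsHelly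

/-- The disjoint union of `G` and the chordless path on `l` vertices `0, 1, …, l - 1`, plus all
edges between the first vertex of the path and `C` and all edges between the last vertex of the
path and `C'`. -/
def attachPath {V : Type u} (G : SimpleGraph V) (C C' : Set V) (l : ℕ) :
    SimpleGraph (V ⊕ Fin l) :=
  (G ⊕g SimpleGraph.pathGraph l) ⊔
    SimpleGraph.fromRel fun x y => ∃ (a : V) (i : Fin l), x = Sum.inl a ∧ y = Sum.inr i ∧
      ((i.val = 0 ∧ a ∈ C) ∨ (i.val + 1 = l ∧ a ∈ C'))

/-- Gates (up to isomorphism): chordless cycles of length at least 4, and what is obtained from a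
gate by attaching a chordless path with at least two vertices to two disjoint cliques, where a
clique is an inclusion-maximal complete set. -/
inductive IsGate : ∀ {V : Type u}, SimpleGraph V → Prop
  | cycle {V : Type u} (G : SimpleGraph V) (n : ℕ) (hn : 4 ≤ n)
      (e : G ≃g SimpleGraph.cycleGraph n) : IsGate G
  | attach {U V : Type u} (H : SimpleGraph U) (hH : IsGate H) (C C' : Set U)
      (hC : Maximal H.IsClique C) (hC' : Maximal H.IsClique C') (hdisj : Disjoint C C')
      (l : ℕ) (hl : 2 ≤ l) (G : SimpleGraph V) (e : G ≃g attachPath H C C' l) : IsGate G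

/-- A `k`-gate: a gate with exactly `k` (inclusion-maximal) cliques. -/
def IsKGate {V : Type u} (k : ℕ) (G : SimpleGraph V) : Prop :=
  IsGate G ∧ {C : Set V | Maximal G.IsClique C}.ncard = k

/-! Everything is decided locally, at a vertex `q` of the host tree. Call the edges at `q` points. A
path through `q` uses exactly two points, so the paths through `q` are the edges of a graph on the
points. Since the host is a tree and the family is Helly, two such paths are adjacent in `G` if and
only if they share a point, and every nonempty clique of such paths has a common point
(`HellyRep.localStar`).

A gate forces a large degree. In every Helly representation of a gate, all paths pass through one
vertex `q`, and they form a graph on the points without multiple edges and without points of degree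
one (`exists_gateOn`, by induction on the gate: cycles become cycles, attached paths become ears).
In such a graph the maximal cliques are exactly the stars of points, so a `k`-gate needs a host
vertex of degree at least `k`.

Conversely, let `q` have degree greater than `h`. If no point separates two others, pass to an
inclusion-minimal set of paths with this property and build it up from a cycle by ears. Minimality
prevents a path from joining both ends of an ear, so each ear is an admissible attachment and the
result is a gate with one clique per edge at `q` (`TwoConn.exists_isKGate`). Without large gates
there is thus a separating point `a`. Then `q` can be split into two adjacent vertices along the
separation (`exists_split`): every path over the new edge uses `a`, so no new intersections arise
and the Helly property survives (`HellyRep.splitVertex`). Both halves have smaller degree, so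
repeated splitting brings all degrees down to at most `h`; extra leaves then make the maximum degree
exactly `h`. -/

namespace HellyEPT

open SimpleGraph

section

/-! ### Reachability, invariants along walks, and deletion of a vertex. -/

section Reachability

variable {V : Type u} {W : Type v}

theorem reachable_map {G : SimpleGraph V} {H : SimpleGraph W} (f : V → W)
    (hf : ∀ x y, G.Adj x y → H.Reachable (f x) (f y)) {x y : V} (h : G.Reachable x y) :
    H.Reachable (f x) (f y) := by
  obtain ⟨p⟩ := h
  induction p with
  | nil => exact Reachable.refl _
  | cons hxy _ ih => exact (hf _ _ hxy).trans ih

theorem iff_of_reachable {G : SimpleGraph V} {P : V → Prop}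
    (hP : ∀ x y, G.Adj x y → (P x ↔ P y)) {x y : V} (h : G.Reachable x y) : P x ↔ P y := by
  obtain ⟨p⟩ := h
  induction p with
  | nil => exact Iff.rfl
  | cons hxy _ ih => exact (hP _ _ hxy).trans ih

/-- The graph with all edges at `q` removed. -/
def avoid (T : SimpleGraph V) (q : V) : SimpleGraph V where
  Adj x y := T.Adj x y ∧ x ≠ q ∧ y ≠ q
  symm := ⟨fun _ _ h => ⟨h.1.symm, h.2.2, h.2.1⟩⟩
  loopless := ⟨fun _ h => h.1.ne rfl⟩

theorem avoid_le (T : SimpleGraph V) (q : V) : avoid T q ≤ T := fun _ _ h => h.1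

theorem ne_of_mem_support_avoid {T : SimpleGraph V} {q x y : V} (p : (avoid T q).Walk x y)
    (hx : x ≠ q) {z : V} (hz : z ∈ p.support) : z ≠ q := by
  induction p with
  | nil => simp only [Walk.support_nil, List.mem_singleton] at hz; exact hz ▸ hx
  | cons h _ ih =>
    simp only [Walk.support_cons, List.mem_cons] at hz
    rcases hz with rfl | hz
    · exact hx
    · exact ih h.2.2 hz

theorem reachable_avoid_of_notMem_support {T : SimpleGraph V} {q x y : V} (p : T.Walk x y)
    (hq : q ∉ p.support) {z : V} (hz : z ∈ p.support) : (avoid T q).Reachable x z := by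
  induction p with
  | nil => simp only [Walk.support_nil, List.mem_singleton] at hz; exact hz ▸ Reachable.refl _
  | @cons a b c h p ih =>
    simp only [Walk.support_cons, List.mem_cons, not_or] at hz hq
    rcases hz with rfl | hz
    · exact Reachable.refl _
    · have : (avoid T q).Adj a b :=
        ⟨h, fun h => hq.1 h.symm, fun h => hq.2 (h ▸ p.start_mem_support)⟩
      exact this.reachable.trans (ih hq.2 hz)

end Reachability

/-! ### Paths of a tree as sets of separating edges, and directions at a vertex. -/

section Tree

variable {W : Type v} {T : SimpleGraph W}

/-- The edges separating `s` from `t`; in a tree, these are the edges of the path from `s`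
to `t`. -/
def between (T : SimpleGraph W) (s t : W) : Set (Sym2 W) :=
  {e | e ∈ T.edgeSet ∧ ¬ (T.deleteEdges {e}).Reachable s t}

theorem between_comm (s t : W) : between T s t = between T t s := by
  ext e; simp only [between, Set.mem_ofPred_eq, reachable_comm]

/-- By uniqueness of paths, an edge of the path cannot be bypassed. This makes a representation
depend only on the ends of its paths, so that later arguments concern reachability instead of walks.
-/
theorem edgeSet_eq_between (hT : T.IsTree) {s t : W} (p : T.Path s t) :
    p.1.edgeSet = between T s t := by
  ext e
  constructor
  · intro he
    refine ⟨p.1.edges_subset_edgeSet he, fun h => ?_⟩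
    obtain ⟨r, hr⟩ := h.exists_isPath
    have h1 := (hT.isAcyclic.subsingleton_path _ _).elim p ⟨r.mapLe (deleteEdges_le _), hr.mapLe _⟩
    rw [h1, Walk.mem_edgeSet] at he
    have h2 := r.edges_subset_edgeSet (by simpa using he)
    simp at h2
  · rintro ⟨-, h⟩
    by_contra hc
    refine h ⟨p.1.toDeleteEdges {e} ?_⟩
    rintro f hf rfl
    exact hc hf

theorem exists_branch (hT : T.IsTree) (q w : W) :
    ∃ y, (w = q → y = q) ∧ (w ≠ q → T.Adj q y ∧ (avoid T q).Reachable y w) := by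
  by_cases hw : w = q
  · exact ⟨q, fun _ => rfl, fun h => (h hw).elim⟩
  · obtain ⟨p, hp, -⟩ := hT.existsUnique_path q w
    cases p with
    | nil => exact (hw rfl).elim
    | @cons _ y _ h p =>
      refine ⟨y, fun h => (hw h).elim, fun _ => ⟨h, ?_⟩⟩
      exact reachable_avoid_of_notMem_support p ((Walk.cons_isPath_iff _ _).1 hp).2
        p.end_mem_support

open Classical in
/-- The neighbor of `q` in the direction of `w`, and `q` itself if `w = q`. -/
noncomputable def branch (T : SimpleGraph W) (q w : W) : W :=
  if h : ∃ y, (w = q → y = q) ∧ (w ≠ q → T.Adj q y ∧ (avoid T q).Reachable y w)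
  then h.choose else q

theorem branch_self (hT : T.IsTree) (q : W) : branch T q q = q := by
  rw [branch, dif_pos (exists_branch hT q q)]
  exact (exists_branch hT q q).choose_spec.1 rfl

theorem branch_spec (hT : T.IsTree) {q w : W} (hw : w ≠ q) :
    T.Adj q (branch T q w) ∧ (avoid T q).Reachable (branch T q w) w := by
  rw [branch, dif_pos (exists_branch hT q w)]
  exact (exists_branch hT q w).choose_spec.2 hw

/-- Otherwise there would be two paths from `y` to `z`, one through `q` and one avoiding it. This
makes the direction `branch` unique. -/
theorem eq_of_reachable_avoid (hT : T.IsTree) {q y z : W} (hy : T.Adj q y) (hz : T.Adj q z)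
    (h : (avoid T q).Reachable y z) : y = z := by
  by_contra hne
  obtain ⟨r, hr⟩ := h.exists_isPath
  have hp : (Walk.cons hy.symm (Walk.cons hz Walk.nil)).IsPath := by
    simp [hy.ne.symm, hz.ne, hne]
  have h1 := (hT.isAcyclic.subsingleton_path _ _).elim ⟨_, hp⟩ ⟨r.mapLe (avoid_le _ _), hr.mapLe _⟩
  have h2 : q ∈ (r.mapLe (avoid_le T q)).support := by
    have := congrArg (fun p : T.Path y z => p.1.support) h1
    simp only at this
    rw [← this]; simp
  exact ne_of_mem_support_avoid r hy.ne.symm (by simpa using h2) rfl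

theorem branch_eq_of_reachable (hT : T.IsTree) {q x y : W} (hx : x ≠ q) (hy : y ≠ q)
    (h : (avoid T q).Reachable x y) : branch T q x = branch T q y :=
  eq_of_reachable_avoid hT (branch_spec hT hx).1 (branch_spec hT hy).1
    (((branch_spec hT hx).2.trans h).trans (branch_spec hT hy).2.symm)

theorem branch_eq_of_adj (hT : T.IsTree) {q x y : W} (hx : x ≠ q) (hy : y ≠ q)
    (h : T.Adj x y) : branch T q x = branch T q y :=
  branch_eq_of_reachable hT hx hy (Adj.reachable ⟨h, hx, hy⟩)

theorem branch_of_adj (hT : T.IsTree) {q y : W} (h : T.Adj q y) : branch T q y = y :=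
  eq_of_reachable_avoid hT (branch_spec hT h.ne.symm).1 h (branch_spec hT h.ne.symm).2

/-- The path from `s` to `t` uses the edge from `q` to its neighbor `y` if and only if exactly one
of `s` and `t` lies in the direction of `y`. -/
theorem mem_between_iff (hT : T.IsTree) {q y s t : W} (hy : T.Adj q y) :
    s(q, y) ∈ between T s t ↔ ¬ (branch T q s = y ↔ branch T q t = y) := by
  constructor
  · rintro ⟨-, h⟩ hst
    apply h
    have hav : avoid T q ≤ T.deleteEdges {s(q, y)} := by
      intro a b hab
      refine deleteEdges_adj.2 ⟨hab.1, fun h => ?_⟩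
      rcases Sym2.eq_iff.1 h with h | h
      · exact hab.2.1 h.1
      · exact hab.2.2 h.2
    have hout : ∀ w, branch T q w ≠ y → (T.deleteEdges {s(q, y)}).Reachable q w := by
      intro w hw
      by_cases hwq : w = q
      · rw [hwq]
      · obtain ⟨h1, h2⟩ := branch_spec hT hwq
        refine Reachable.trans (Adj.reachable ?_) (h2.mono hav)
        refine deleteEdges_adj.2 ⟨h1, fun h => ?_⟩
        rcases Sym2.eq_iff.1 h with h | h
        · exact hw h.2
        · exact hy.ne h.1
    have hin : ∀ w, branch T q w = y → (T.deleteEdges {s(q, y)}).Reachable y w := by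
      intro w hw
      have hwq : w ≠ q := by
        rintro rfl
        rw [branch_self hT] at hw
        exact hy.ne hw
      have h2 := (branch_spec hT hwq).2
      rw [hw] at h2
      exact h2.mono hav
    by_cases hs : branch T q s = y
    · exact (hin s hs).symm.trans (hin t (hst.1 hs))
    · exact (hout s hs).symm.trans (hout t (fun ht => hs (hst.2 ht)))
  · intro h
    refine ⟨hy, fun hr => h (iff_of_reachable (P := fun w => branch T q w = y) ?_ hr)⟩
    intro a b h
    obtain ⟨hab, hne⟩ := deleteEdges_adj.1 h
    by_cases ha : a = q
    · subst ha
      have hb : b ≠ y := fun h => hne (by rw [h]; rfl)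
      simp only [branch_self hT, branch_of_adj hT hab, hb, hy.ne]
    · by_cases hb : b = q
      · subst hb
        have ha' : a ≠ y := fun h => hne (by rw [h]; exact Sym2.eq_swap)
        simp only [branch_self hT, branch_of_adj hT hab.symm, ha', hy.ne]
      · simp only [branch_eq_of_adj hT ha hb hab]

/-- A path using an edge in some direction from `q` has an end in that direction. -/
theorem branch_eq_or_of_mem_between (hT : T.IsTree) {q s t u : W} {g : Sym2 W}
    (hg : g ∈ between T s t) (hu : u ∈ g) (huq : u ≠ q) :
    branch T q s = branch T q u ∨ branch T q t = branch T q u := by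
  classical
  by_contra! hc
  obtain ⟨hs, ht⟩ := hc
  -- The walk from `q` into a direction other than that of `u` never visits `u`, hence never uses
  -- `g`.
  have key : ∀ w, branch T q w ≠ branch T q u → (T.deleteEdges {g}).Reachable q w := by
    intro w hw
    by_cases hwq : w = q
    · rw [hwq]
    obtain ⟨h1, h2⟩ := branch_spec hT hwq
    have hadj : ∀ a b, T.Adj a b → a ≠ u → b ≠ u → (T.deleteEdges {g}).Adj a b := by
      intro a b hab ha hb
      refine deleteEdges_adj.2 ⟨hab, fun h => ?_⟩
      rw [Set.mem_singleton_iff] at h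
      subst h
      rcases Sym2.mem_iff.1 hu with h | h
      · exact ha h.symm
      · exact hb h.symm
    have hbw : branch T q w ≠ u := fun h => hw (by
      rw [← branch_of_adj hT h1, h])
    refine (hadj _ _ h1 huq.symm hbw).reachable.trans ?_
    obtain ⟨p, hp⟩ := h2.exists_isPath
    refine ⟨p.transfer _ ?_⟩
    intro e he
    have hne : ∀ z ∈ p.support, z ≠ u := by
      rintro z hz rfl
      refine hw (branch_eq_of_reachable hT hwq huq ?_)
      exact (p.dropUntil z hz).reachable.symm
    induction e with
    | h a b =>
      exact hadj a b (p.edges_subset_edgeSet he).1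
        (hne a (p.fst_mem_support_of_mem_edges he)) (hne b (p.snd_mem_support_of_mem_edges he))
  exact hg.2 ((key s hs).symm.trans (key t ht))

theorem eq_branch_of_mem_between (hT : T.IsTree) {q y s t : W} (h : s(q, y) ∈ between T s t) :
    T.Adj q y ∧ (y = branch T q s ∨ y = branch T q t) := by
  have hy : T.Adj q y := h.1
  rw [mem_between_iff hT hy] at h
  refine ⟨hy, ?_⟩
  by_contra! hc
  exact h ⟨fun h => (hc.1 h.symm).elim, fun h => (hc.2 h.symm).elim⟩

/-- If a path contains edges in two different directions from `q`, it uses both edges at `q`. -/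
theorem mem_between_of_branch_ne (hT : T.IsTree) {q s t u u' : W} {g g' : Sym2 W}
    (hg : g ∈ between T s t) (hg' : g' ∈ between T s t) (hu : u ∈ g) (hu' : u' ∈ g')
    (huq : u ≠ q) (huq' : u' ≠ q) (hne : branch T q u ≠ branch T q u') :
    s(q, branch T q u) ∈ between T s t := by
  rw [mem_between_iff hT (branch_spec hT huq).1]
  have h1 := branch_eq_or_of_mem_between hT hg hu huq
  have h2 := branch_eq_or_of_mem_between hT hg' hu' huq'
  grind

/-- A path passing through `q` that uses an edge in some direction from `q` uses the edge at `q`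
in that direction. -/
theorem mem_between_of_through (hT : T.IsTree) {q s t u y z : W} {g : Sym2 W}
    (hy : s(q, y) ∈ between T s t) (hz : s(q, z) ∈ between T s t) (hyz : y ≠ z)
    (hg : g ∈ between T s t) (hu : u ∈ g) (huq : u ≠ q) :
    s(q, branch T q u) ∈ between T s t := by
  have h1 := branch_eq_or_of_mem_between hT hg hu huq
  have h2 := (eq_branch_of_mem_between hT hy).2
  have h3 := (eq_branch_of_mem_between hT hz).2
  have : branch T q u = y ∨ branch T q u = z := by grind
  rcases this with h | h <;> rwa [h]

theorem exists_mem_ne_of_mem_edgeSet {g : Sym2 W} (hg : g ∈ T.edgeSet) (q : W) :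
    ∃ u ∈ g, u ≠ q := by
  induction g with
  | h a b =>
    by_cases ha : a = q
    · exact ⟨b, by simp, fun hb => hg.ne (ha.trans hb.symm)⟩
    · exact ⟨a, by simp, ha⟩

end Tree

end

/-! ### The graph of paths on the points at a vertex: stars, cliques and ears. -/

section

variable {V : Type u} {W : Type v}

/-- `v` is incident with two different points. -/
def Through (inc : V → W → Prop) (v : V) : Prop := ∃ y z, y ≠ z ∧ inc v y ∧ inc v z

/-- The points incident with a member of `S`. -/
def points (inc : V → W → Prop) (S : Set V) : Set W := {y | ∃ v ∈ S, inc v y}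

/-- What the paths of a Helly representation look like near a vertex of the host tree: the points
are the edges at that vertex, and each path uses at most two of them. -/
structure LocalStar (G : SimpleGraph V) (inc : V → W → Prop) : Prop where
  eq_or_eq : ∀ {v x y z}, inc v x → inc v y → inc v z → x ≠ y → z = x ∨ z = y
  adj_iff : ∀ {v w}, v ≠ w → Through inc v → Through inc w → (G.Adj v w ↔ ∃ y, inc v y ∧ inc w y)
  helly : ∀ Q : Set V, Q.Nonempty → (∀ v ∈ Q, Through inc v) → G.IsClique Q → ∃ y, ∀ v ∈ Q, inc v y

theorem LocalStar.induce {G : SimpleGraph V} {inc : V → W → Prop} (h : LocalStar G inc)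
    (S : Set V) : LocalStar (G.induce S) (fun v : S => inc v) where
  eq_or_eq := h.eq_or_eq
  adj_iff hvw hv hw := h.adj_iff (fun h => hvw (Subtype.ext h)) hv hw
  helly Q hQ hQt hQc := by
    obtain ⟨y, hy⟩ := h.helly (Subtype.val '' Q) (hQ.image _)
      (by rintro _ ⟨v, hv, rfl⟩; exact hQt v hv)
      (by
        rintro _ ⟨v, hv, rfl⟩ _ ⟨w, hw, rfl⟩ hne
        exact hQc hv hw (fun h => hne (congrArg _ h)))
    exact ⟨y, fun v hv => hy v ⟨v, hv, rfl⟩⟩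

/-- The members of `S`, each joining two points, form a graph on the points without multiple
edges and without points of degree one. -/
structure GateOn (inc : V → W → Prop) (S : Set V) : Prop where
  through : ∀ v ∈ S, Through inc v
  two : ∀ v ∈ S, ∀ y, inc v y → ∃ w ∈ S, w ≠ v ∧ inc w y
  simple : ∀ v ∈ S, ∀ w ∈ S, v ≠ w → ∀ y z, y ≠ z → inc v y → inc v z → inc w y → inc w z → False

theorem GateOn.subtype {inc : V → W → Prop} {S : Set V} (h : GateOn inc S) :
    GateOn (fun v : S => inc v) Set.univ where
  through v _ := h.through v v.2
  two v _ y hy := by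
    obtain ⟨w, hw, hne, hwy⟩ := h.two v v.2 y hy
    exact ⟨⟨w, hw⟩, trivial, fun h => hne (congrArg Subtype.val h), hwy⟩
  simple v _ w _ hne := h.simple v v.2 w w.2 (fun h => hne (Subtype.ext h))

theorem GateOn.range {U : Type u} {inc : V → W → Prop} {f : U → V}
    (h : GateOn (fun x => inc (f x)) Set.univ) (hf : Function.Injective f) :
    GateOn inc (Set.range f) where
  through := by rintro _ ⟨x, rfl⟩; exact h.through x trivial
  two := by
    rintro _ ⟨x, rfl⟩ y hy
    obtain ⟨w, -, hne, hwy⟩ := h.two x trivial y hy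
    exact ⟨f w, ⟨w, rfl⟩, fun h => hne (hf h), hwy⟩
  simple := by
    rintro _ ⟨x, rfl⟩ _ ⟨w, rfl⟩ hne
    exact h.simple x trivial w trivial (fun h => hne (congrArg _ h))

theorem GateOn.isClique {G : SimpleGraph V} {inc : V → W → Prop} (hL : LocalStar G inc)
    (h : GateOn inc Set.univ) (y : W) : G.IsClique {v | inc v y} := by
  intro v hv w hw hne
  exact (hL.adj_iff hne (h.through v trivial) (h.through w trivial)).2 ⟨y, hv, hw⟩

/-- At `y` there are two members; if both were also incident with another point `z`, they would be
parallel. -/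
theorem GateOn.eq_of_subset {inc : V → W → Prop} (h : GateOn inc Set.univ) {v : V} {y z : W}
    (hv : inc v y) (hyz : {x | inc x y} ⊆ {x | inc x z}) : y = z := by
  by_contra hne
  obtain ⟨w, -, hwv, hw⟩ := h.two v trivial y hv
  exact h.simple v trivial w trivial hwv.symm y z hne hv (hyz hv) hw (hyz hw)

/-- A clique containing the star of `y` lies in the star of some `z` by the Helly property, and the
inclusion of stars forces `y = z`. -/
theorem GateOn.maximal_isClique {G : SimpleGraph V} {inc : V → W → Prop} (hL : LocalStar G inc)
    (h : GateOn inc Set.univ) {y : W} (hy : y ∈ points inc Set.univ) :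
    Maximal G.IsClique {v | inc v y} := by
  obtain ⟨v, -, hv⟩ := hy
  refine ⟨h.isClique hL y, fun D hD hyD => ?_⟩
  obtain ⟨z, hz⟩ := hL.helly D ⟨v, hyD hv⟩ (fun v _ => h.through v trivial) hD
  have := h.eq_of_subset hv (fun x hx => hz x (hyD hx))
  subst this
  exact hz

theorem nonempty_of_maximal_isClique [Nonempty V] {G : SimpleGraph V} {C : Set V}
    (hC : Maximal G.IsClique C) : C.Nonempty := by
  by_contra hc
  rw [Set.not_nonempty_iff_eq_empty] at hc
  obtain ⟨v⟩ := ‹Nonempty V›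
  have := hC.2 (G.isClique_singleton v) (by rw [hc]; exact Set.empty_subset _)
  rw [hc] at this
  exact this rfl

theorem GateOn.exists_eq_of_maximal [Nonempty V] {G : SimpleGraph V} {inc : V → W → Prop}
    (hL : LocalStar G inc) (h : GateOn inc Set.univ) {C : Set V} (hC : Maximal G.IsClique C) :
    ∃ y, C = {v | inc v y} := by
  obtain ⟨y, hy⟩ := hL.helly C (nonempty_of_maximal_isClique hC) (fun v _ => h.through v trivial)
    hC.1
  exact ⟨y, Set.Subset.antisymm hy (hC.2 (h.isClique hL y) hy)⟩

/-- The maximal cliques correspond to the points. -/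
theorem GateOn.ncard_maximal_isClique [Nonempty V] {G : SimpleGraph V} {inc : V → W → Prop}
    (hL : LocalStar G inc) (h : GateOn inc Set.univ) :
    {C : Set V | Maximal G.IsClique C}.ncard = (points inc Set.univ).ncard := by
  have himg : {C : Set V | Maximal G.IsClique C} =
      (fun y => {v | inc v y}) '' points inc Set.univ := by
    ext C
    constructor
    · intro hC
      obtain ⟨y, rfl⟩ := h.exists_eq_of_maximal hL hC
      obtain ⟨v, hv⟩ := nonempty_of_maximal_isClique hC
      exact ⟨y, ⟨v, trivial, hv⟩, rfl⟩
    · rintro ⟨y, hy, rfl⟩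
      exact h.maximal_isClique hL hy
  rw [himg]
  apply Set.InjOn.ncard_image
  rintro y ⟨v, -, hv⟩ z - hyz
  exact h.eq_of_subset hv hyz.le

/-- A path with at least two edges `e 0, …, e (l - 1)` and points `b 0, …, b l`, which has exactly
its ends in `K`. -/
structure IsEar (inc : V → W → Prop) (K : Set W) (b : ℕ → W) (e : ℕ → V) (l : ℕ) : Prop where
  two_le : 2 ≤ l
  start_mem : b 0 ∈ K
  end_mem : b l ∈ K
  inj : ∀ i ≤ l, ∀ j ≤ l, b i = b j → i = j
  notMem : ∀ i, 0 < i → i < l → b i ∉ K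
  left : ∀ i < l, inc (e i) (b i)
  right : ∀ i < l, inc (e i) (b (i + 1))

namespace IsEar

variable {G : SimpleGraph V} {inc : V → W → Prop} {K : Set W} {b : ℕ → W} {e : ℕ → V} {l : ℕ}

theorem through (h : IsEar inc K b e l) {i : ℕ} (hi : i < l) : Through inc (e i) :=
  ⟨b i, b (i + 1), fun hb => by have := h.inj i hi.le (i + 1) hi hb; omega, h.left i hi,
    h.right i hi⟩

theorem eq_or_eq (hL : LocalStar G inc) (h : IsEar inc K b e l) {i : ℕ} (hi : i < l) {y : W}
    (hy : inc (e i) y) : y = b i ∨ y = b (i + 1) :=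
  hL.eq_or_eq (h.left i hi) (h.right i hi) hy
    (fun hb => by have := h.inj i hi.le (i + 1) hi hb; omega)

theorem edge_inj (hL : LocalStar G inc) (h : IsEar inc K b e l) {i j : ℕ} (hi : i < l) (hj : j < l)
    (hij : e i = e j) : i = j := by
  have h1 := h.eq_or_eq hL hj (hij ▸ h.left i hi)
  have h2 := h.eq_or_eq hL hj (hij ▸ h.right i hi)
  have a1 := h.inj i hi.le j hj.le
  have a2 := h.inj i hi.le (j + 1) hj
  have a3 := h.inj (i + 1) hi j hj.le
  have a4 := h.inj (i + 1) hi (j + 1) hj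
  rcases h1 with h1 | h1
  · exact a1 h1
  · rcases h2 with h2 | h2
    · have := a2 h1; have := a3 h2; omega
    · have := a4 h2; omega

/-- An edge of an ear has an end outside `K`. -/
theorem exists_notMem (h : IsEar inc K b e l) {i : ℕ} (hi : i < l) :
    ∃ y, inc (e i) y ∧ y ∉ K := by
  rcases Nat.eq_zero_or_pos i with rfl | h0
  · exact ⟨b 1, h.right 0 hi, h.notMem 1 one_pos h.two_le⟩
  · exact ⟨b i, h.left i hi, h.notMem i h0 hi⟩

theorem notMem_edges {S : Set V} (h : IsEar inc (points inc S) b e l) {i : ℕ} (hi : i < l) :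
    e i ∉ S := by
  intro hS
  obtain ⟨y, hy, hyK⟩ := h.exists_notMem hi
  exact hyK ⟨_, hS, hy⟩

end IsEar

/-- The hypothesis `two` leaves out the ends of the ear, which receive a further member from it.
Hence `S` may also be a single edge, whose ear closes it to a cycle. -/
theorem GateOn.ear {G : SimpleGraph V} {inc : V → W → Prop} {b : ℕ → W} {e : ℕ → V} {l : ℕ}
    {S : Set V} (hL : LocalStar G inc) (hE : IsEar inc (points inc S) b e l)
    (through : ∀ v ∈ S, Through inc v)
    (two : ∀ v ∈ S, ∀ y, inc v y → (∃ w ∈ S, w ≠ v ∧ inc w y) ∨ y = b 0 ∨ y = b l)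
    (simple : ∀ v ∈ S, ∀ w ∈ S, v ≠ w → ∀ y z, y ≠ z → inc v y → inc v z → inc w y → inc w z →
      False) :
    GateOn inc (S ∪ {v | ∃ i < l, e i = v}) where
  through := by
    rintro v (hv | ⟨i, hi, rfl⟩)
    · exact through v hv
    · exact hE.through hi
  two := by
    have h2 := hE.two_le
    rintro v (hv | ⟨i, hi, rfl⟩) y hy
    · rcases two v hv y hy with ⟨w, hw, hne, hwy⟩ | rfl | rfl
      · exact ⟨w, Or.inl hw, hne, hwy⟩
      · exact ⟨e 0, Or.inr ⟨0, by omega, rfl⟩,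
          fun h => hE.notMem_edges (i := 0) (by omega) (h ▸ hv), hE.left 0 (by omega)⟩
      · have := hE.right (l - 1) (by omega)
        rw [Nat.sub_add_cancel (by omega)] at this
        exact ⟨e (l - 1), Or.inr ⟨l - 1, by omega, rfl⟩,
          fun h => hE.notMem_edges (i := l - 1) (by omega) (h ▸ hv), this⟩
    · rcases hE.eq_or_eq hL hi hy with rfl | rfl
      · rcases Nat.eq_zero_or_pos i with rfl | h0
        · obtain ⟨w, hw, hwb⟩ := hE.start_mem
          exact ⟨w, Or.inl hw, fun h => hE.notMem_edges hi (h ▸ hw), hwb⟩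
        · have := hE.right (i - 1) (by omega)
          rw [Nat.sub_add_cancel (by omega)] at this
          refine ⟨e (i - 1), Or.inr ⟨i - 1, by omega, rfl⟩, fun h => ?_, this⟩
          have := hE.edge_inj hL (by omega) hi h
          omega
      · by_cases hil : i + 1 = l
        · obtain ⟨w, hw, hwb⟩ := hE.end_mem
          exact ⟨w, Or.inl hw, fun h => hE.notMem_edges hi (h ▸ hw), hil ▸ hwb⟩
        · refine ⟨e (i + 1), Or.inr ⟨i + 1, by omega, rfl⟩, fun h => ?_, hE.left _ (by omega)⟩
          have := hE.edge_inj hL (by omega) hi h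
          omega
  simple := by
    -- An ear edge has an end outside the old points, because the ear has at least two edges; so it
    -- is not parallel to an old member.
    have mixed : ∀ v ∈ S, ∀ i < l, ∀ y z, y ≠ z → inc v y → inc v z → inc (e i) y →
        inc (e i) z → False := by
      intro v hv i hi y z hne h1 h2 h3 h4
      obtain ⟨x, hx, hxK⟩ := hE.exists_notMem hi
      rcases hL.eq_or_eq h3 h4 hx hne with rfl | rfl
      · exact hxK ⟨v, hv, h1⟩
      · exact hxK ⟨v, hv, h2⟩
    rintro v (hv | ⟨i, hi, rfl⟩) w (hw | ⟨j, hj, rfl⟩) hvw y z hne h1 h2 h3 h4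
    · exact simple v hv w hw hvw y z hne h1 h2 h3 h4
    · exact mixed v hv j hj y z hne h1 h2 h3 h4
    · exact mixed w hw i hi y z hne h3 h4 h1 h2
    · have hij : i ≠ j := fun h => hvw (h ▸ rfl)
      have a1 := hE.inj i hi.le j hj.le
      have a2 := hE.inj i hi.le (j + 1) hj
      have a3 := hE.inj (i + 1) hi j hj.le
      have a4 := hE.inj (i + 1) hi (j + 1) hj
      have c1 := hE.eq_or_eq hL hi h1
      have c2 := hE.eq_or_eq hL hi h2
      have c3 := hE.eq_or_eq hL hj h3
      have c4 := hE.eq_or_eq hL hj h4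
      grind

end

/-! ### Helly representations near a vertex, and how chains of paths cross it. -/

section

variable {V : Type u} {W : Type v} {T : SimpleGraph W}

/-- The paths of the tree `T` between `s x` and `t x` form a Helly EPT representation of `G`. -/
structure HellyRep (G : SimpleGraph V) (T : SimpleGraph W) (s t : V → W) : Prop where
  adj_iff : ∀ x y : V, x ≠ y →
    (G.Adj x y ↔ (between T (s x) (t x) ∩ between T (s y) (t y)).Nonempty)
  helly : HellyProperty fun x : V => between T (s x) (t x)

theorem hellyRep_of_isHelly {G : SimpleGraph V} (hT : T.IsTree) (R : EPTRepresentation G T)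
    (hR : R.IsHelly) : HellyRep G T R.src R.tgt where
  adj_iff x y hxy := by
    rw [← edgeSet_eq_between hT (R.path x), ← edgeSet_eq_between hT (R.path y)]
    exact R.adj_iff x y hxy
  helly := by
    simp only [← edgeSet_eq_between hT (R.path _)]
    exact hR

theorem exists_isHelly_of_hellyRep {G : SimpleGraph V} (hT : T.IsTree) {s t : V → W}
    (h : HellyRep G T s t) : ∃ R : EPTRepresentation G T, R.IsHelly := by
  have hp : ∀ x, Nonempty (T.Path (s x) (t x)) := fun x =>
    let ⟨p, hp, _⟩ := hT.existsUnique_path (s x) (t x)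
    ⟨⟨p, hp⟩⟩
  have p := fun x => Classical.choice (hp x)
  refine ⟨⟨s, t, p, fun x y hxy => ?_⟩, ?_⟩
  · rw [edgeSet_eq_between hT, edgeSet_eq_between hT]
    exact h.adj_iff x y hxy
  · simp only [EPTRepresentation.IsHelly, edgeSet_eq_between hT]
    exact h.helly

theorem HellyRep.comp {U : Type*} {G : SimpleGraph V} {H : SimpleGraph U} {s t : V → W}
    (h : HellyRep G T s t) (f : H ↪g G) : HellyRep H T (s ∘ f) (t ∘ f) where
  adj_iff x y hxy := by
    rw [← f.map_adj_iff]
    exact h.adj_iff _ _ (fun h => hxy (f.injective h))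
  helly I hI hp := by
    obtain ⟨g, hg⟩ := h.helly (f '' I) (hI.image f) (by
      rintro _ ⟨x, hx, rfl⟩ _ ⟨y, hy, rfl⟩ hne
      exact hp hx hy (fun h => hne (congrArg _ h)))
    refine ⟨g, ?_⟩
    simp only [Set.mem_iInter] at hg ⊢
    exact fun x hx => hg (f x) ⟨x, hx, rfl⟩

/-- The path of `v` uses the edge from `q` to `y`. -/
def Uses (T : SimpleGraph W) (s t : V → W) (q : W) (v : V) (y : W) : Prop :=
  s(q, y) ∈ between T (s v) (t v)

/-- A common edge `g` of paths through `q` lies in one direction from `q`, and each of these paths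
must use the edge at `q` in that direction. So common edges can be moved to `q`. -/
theorem HellyRep.localStar {G : SimpleGraph V} {s t : V → W} (hT : T.IsTree)
    (h : HellyRep G T s t) (q : W) : LocalStar G (Uses T s t q) where
  eq_or_eq hx hy hz hne := by
    have h1 := (eq_branch_of_mem_between hT hx).2
    have h2 := (eq_branch_of_mem_between hT hy).2
    have h3 := (eq_branch_of_mem_between hT hz).2
    grind
  adj_iff {v w} hvw := by
    rintro ⟨y, z, hyz, hy, hz⟩ ⟨y', z', hyz', hy', hz'⟩
    rw [h.adj_iff v w hvw]
    constructor
    · rintro ⟨g, hgv, hgw⟩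
      obtain ⟨u, hu, huq⟩ := exists_mem_ne_of_mem_edgeSet hgv.1 q
      exact ⟨_, mem_between_of_through hT hy hz hyz hgv hu huq,
        mem_between_of_through hT hy' hz' hyz' hgw hu huq⟩
    · rintro ⟨y, h1, h2⟩
      exact ⟨_, h1, h2⟩
  helly Q hQ hQt hQc := by
    obtain ⟨g, hg⟩ := h.helly Q hQ (fun v hv w hw hne => (h.adj_iff v w hne).1 (hQc hv hw hne))
    simp only [Set.mem_iInter] at hg
    obtain ⟨v, hv⟩ := hQ
    obtain ⟨u, hu, huq⟩ := exists_mem_ne_of_mem_edgeSet (hg v hv).1 q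
    refine ⟨branch T q u, fun w hw => ?_⟩
    obtain ⟨y, z, hyz, hy, hz⟩ := hQt w hw
    exact mem_between_of_through hT hy hz hyz (hg w hw) hu huq

/-- Once `b` stalls, it can never leave its value: the member leaving it later would share a point
with a member too far back (`hfar`), or be a second one at `b 0` (`h0`). So `b` stays there up to
`l`, which contradicts `hne`, or `hl` for the member that arrived there. -/
theorem succ_ne_of_leaves {inc : ℕ → W → Prop} {b : ℕ → W} {l : ℕ} (hne : b 0 ≠ b l)
    (hstep : ∀ i < l, b i ≠ b (i + 1) → inc i (b i) ∧ inc i (b (i + 1)))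
    (h0 : ∀ i < l, inc i (b 0) → i = 0) (hl : ∀ i < l, inc i (b l) → i + 1 = l)
    (hfar : ∀ i < l, ∀ j < l, ∀ y, inc i y → inc j y → j ≤ i + 1) :
    ∀ i < l, b i ≠ b (i + 1) := by
  intro i
  induction i with
  | zero =>
    intro hi heq
    have : ∀ j, j + 1 ≤ l → b (j + 1) = b 0 := by
      intro j
      induction j with
      | zero => intro _; exact heq.symm
      | succ j ih =>
        intro hj
        by_contra hc
        rw [← ih (by omega)] at hc
        have h1 := (hstep (j + 1) hj (Ne.symm hc)).1
        rw [ih (by omega)] at h1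
        have := h0 _ hj h1
        omega
    have := this (l - 1) (by omega)
    rw [Nat.sub_add_cancel (by omega)] at this
    exact hne this.symm
  | succ i ih =>
    intro hi heq
    have hi' := (hstep i (by omega) (ih (by omega))).2
    have : ∀ j, i + 1 + j ≤ l → b (i + 1 + j) = b (i + 1) := by
      intro j
      induction j with
      | zero => intro _; rfl
      | succ j ihj =>
        intro hj
        by_contra hc
        have e1 := ihj (by omega)
        rw [← e1] at hc
        have h1 := (hstep (i + 1 + j) (by omega) (Ne.symm hc)).1
        rw [e1] at h1
        have := hfar i (by omega) (i + 1 + j) (by omega) _ hi' h1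
        have : j = 0 := by omega
        subst this
        exact hc heq.symm
    have := this (l - (i + 1)) (by omega)
    rw [Nat.add_sub_cancel' (by omega)] at this
    rw [← this] at hi'
    have := hl i (by omega) hi'
    omega

/-- A chordless sequence of paths of a tree that leads from one direction at `q` to another one
passes through `q` in a simple path of edges at `q`. -/
theorem exists_chain (hT : T.IsTree) {s t : V → W} {q : W} {e : ℕ → V} {l : ℕ}
    {g₀ g₁ : Sym2 W} {u₀ u₁ : W} (hl0 : 0 < l)
    (hcons : ∀ i, i + 1 < l →
      (between T (s (e i)) (t (e i)) ∩ between T (s (e (i + 1))) (t (e (i + 1)))).Nonempty)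
    (hg₀ : g₀ ∈ between T (s (e 0)) (t (e 0))) (hu₀ : u₀ ∈ g₀) (hq₀ : u₀ ≠ q)
    (hg₁ : g₁ ∈ between T (s (e (l - 1))) (t (e (l - 1)))) (hu₁ : u₁ ∈ g₁) (hq₁ : u₁ ≠ q)
    (hne : branch T q u₀ ≠ branch T q u₁)
    (h0 : ∀ i < l, Uses T s t q (e i) (branch T q u₀) → i = 0)
    (hl : ∀ i < l, Uses T s t q (e i) (branch T q u₁) → i + 1 = l)
    (hfar : ∀ i < l, ∀ j < l, ∀ y, Uses T s t q (e i) y → Uses T s t q (e j) y → j ≤ i + 1) :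
    ∃ b : ℕ → W, b 0 = branch T q u₀ ∧ b l = branch T q u₁ ∧
      (∀ i ≤ l, ∀ j ≤ l, b i = b j → i = j) ∧
      (∀ i < l, Uses T s t q (e i) (b i)) ∧ ∀ i < l, Uses T s t q (e i) (b (i + 1)) := by
  -- `g` is a common edge of the paths with indices `i - 1` and `i`, with `g₀` and `g₁` at the two
  -- extremes, and `u` is an end of it that determines its direction. Values beyond `l` are
  -- irrelevant.
  have hex : ∀ i, ∃ g : Sym2 W, ∃ u : W, (i ≤ l → u ∈ g ∧ u ≠ q) ∧
      (i < l → g ∈ between T (s (e i)) (t (e i))) ∧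
      (∀ j, j + 1 = i → i ≤ l → g ∈ between T (s (e j)) (t (e j))) ∧
      (i = 0 → u = u₀) ∧ (i = l → u = u₁) := by
    intro i
    rcases Nat.eq_zero_or_pos i with rfl | hi
    · exact ⟨g₀, u₀, fun _ => ⟨hu₀, hq₀⟩, fun _ => hg₀, fun _ h => by omega, fun _ => rfl,
        fun h => by omega⟩
    · rcases lt_trichotomy i l with h | rfl | h
      · obtain ⟨g, hg, hg'⟩ := hcons (i - 1) (by omega)
        rw [Nat.sub_add_cancel hi] at hg'
        obtain ⟨u, hu, huq⟩ := exists_mem_ne_of_mem_edgeSet hg.1 q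
        refine ⟨g, u, fun _ => ⟨hu, huq⟩, fun _ => hg', fun j hj _ => ?_, fun h => by omega,
          fun h => by omega⟩
        have : j = i - 1 := by omega
        rwa [this]
      · refine ⟨g₁, u₁, fun _ => ⟨hu₁, hq₁⟩, fun h => by omega, fun j hj _ => ?_, fun h => by omega,
          fun _ => rfl⟩
        have : j = i - 1 := by omega
        rwa [this]
      · exact ⟨g₀, u₀, fun _ => by omega, fun _ => by omega, fun _ _ _ => by omega,
          fun _ => by omega, fun _ => by omega⟩
  choose g u h1 h2 h3 h4 h5 using hex
  have hstep : ∀ i < l, branch T q (u i) ≠ branch T q (u (i + 1)) →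
      Uses T s t q (e i) (branch T q (u i)) ∧ Uses T s t q (e i) (branch T q (u (i + 1))) := by
    intro i hi hb
    have a1 := h2 i hi
    have a2 := h3 (i + 1) i rfl hi
    obtain ⟨a3, a4⟩ := h1 i hi.le
    obtain ⟨a5, a6⟩ := h1 (i + 1) hi
    exact ⟨mem_between_of_branch_ne hT a1 a2 a3 a5 a4 a6 hb,
      mem_between_of_branch_ne hT a2 a1 a5 a3 a6 a4 hb.symm⟩
  have e0 := h4 0 rfl
  have el := h5 l rfl
  have key := succ_ne_of_leaves (inc := fun i => Uses T s t q (e i))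
    (b := fun i => branch T q (u i)) (by simpa only [e0, el] using hne) hstep
    (by simpa only [e0] using h0) (by simpa only [el] using hl) hfar
  have hlt : ∀ i j, i < j → j ≤ l → branch T q (u i) ≠ branch T q (u j) := by
    intro i j hij hj heq
    have a1 := (hstep i (by omega) (key i (by omega))).1
    rcases hj.lt_or_eq with hj | rfl
    · have a2 := (hstep j hj (key j hj)).1
      rw [← heq] at a2
      have := hfar i (by omega) j hj _ a1 a2
      have : j = i + 1 := by omega
      subst this
      exact key i (by omega) heq
    · rw [heq, el] at a1
      have := hl i (by omega) a1
      subst this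
      exact key i (by omega) heq
  refine ⟨fun i => branch T q (u i), by simp only [e0], by simp only [el], ?_,
    fun i hi => (hstep i hi (key i hi)).1, fun i hi => (hstep i hi (key i hi)).2⟩
  intro i hi j hj hij
  by_contra hc
  rcases Nat.lt_or_gt_of_ne hc with h | h
  · exact hlt i j h hj hij
  · exact hlt j i h hi hij.symm

/-- Follow the path until its first edge in `X`; `q` is the vertex just before that edge, and the
part already traversed avoids `q`. -/
theorem exists_turn_of_cons (X : Set (Sym2 W)) {f : Sym2 W} (hf : f ∈ X) :
    ∀ {c t : W} (p : T.Walk c t) (d : W) (h : T.Adj d c), (Walk.cons h p).IsPath →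
      s(d, c) ∉ X → f ∈ p.edges →
      ∃ q y z, s(q, y) ∈ p.edges ∧ s(q, y) ∈ X ∧ s(q, z) ∈ (Walk.cons h p).edges ∧ s(q, z) ∉ X ∧
        d ≠ q ∧ (avoid T q).Reachable d z := by
  intro c t p
  induction p with
  | nil => intro d h _ _ hfp; simp at hfp
  | @cons c c' t hc p ih =>
    intro d h hp hX hfp
    by_cases hcX : s(c, c') ∈ X
    · refine ⟨c, c', d, by simp, hcX, by simp [Sym2.eq_swap], ?_, h.ne, Reachable.refl _⟩
      rwa [Sym2.eq_swap]
    · have hp' := (Walk.cons_isPath_iff _ _).1 hp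
      have hfp' : f ∈ p.edges := by
        simp only [Walk.edges_cons, List.mem_cons] at hfp
        rcases hfp with rfl | hfp
        · exact (hcX hf).elim
        · exact hfp
      obtain ⟨q, y, z, h1, h2, h3, h4, h5, h6⟩ := ih c hc hp'.1 hcX hfp'
      have hdq : d ≠ q := by
        rintro rfl
        apply hp'.2
        simp only [Walk.support_cons, List.mem_cons]
        exact Or.inr (p.fst_mem_support_of_mem_edges h1)
      refine ⟨q, y, z, by simp [h1], h2, ?_, h4, hdq, ?_⟩
      · rw [Walk.edges_cons]; exact List.mem_cons_of_mem _ h3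
      · exact Reachable.trans (Adj.reachable ⟨h, hdq, h5⟩) h6

theorem exists_eq_append_cons {s t : W} (p : T.Walk s t) {g : Sym2 W} (hg : g ∈ p.edges) :
    ∃ (c d : W) (h : T.Adj c d) (p₁ : T.Walk s c) (p₂ : T.Walk d t),
      g = s(c, d) ∧ p = p₁.append (Walk.cons h p₂) := by
  induction p with
  | nil => simp at hg
  | @cons a b _ h p ih =>
    simp only [Walk.edges_cons, List.mem_cons] at hg
    rcases hg with rfl | hg
    · exact ⟨a, b, h, Walk.nil, p, rfl, rfl⟩
    · obtain ⟨c, d, h', p₁, p₂, h1, h2⟩ := ih hg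
      exact ⟨c, d, h', Walk.cons h p₁, p₂, h1, by rw [h2]; rfl⟩

/-- On a path with an edge `g` outside `X` and an edge in `X`, there is a vertex where the path
enters `X` when coming from `g`. -/
theorem exists_turn (hT : T.IsTree) {s t : W} {X : Set (Sym2 W)} {f g : Sym2 W}
    (hf : f ∈ between T s t) (hfX : f ∈ X) (hg : g ∈ between T s t) (hgX : g ∉ X) :
    ∃ q y z u, s(q, y) ∈ between T s t ∧ s(q, y) ∈ X ∧ s(q, z) ∈ between T s t ∧ s(q, z) ∉ X ∧
      u ∈ g ∧ u ≠ q ∧ branch T q u = z := by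
  obtain ⟨p, hp, -⟩ := hT.existsUnique_path s t
  rw [← edgeSet_eq_between hT ⟨p, hp⟩] at hf hg ⊢
  simp only [Walk.mem_edgeSet] at hf hg ⊢
  obtain ⟨c, d, h, p₁, p₂, rfl, rfl⟩ := exists_eq_append_cons p hg
  -- The path is traversed from `g` towards `f`, in reverse if `f` comes before `g`; this treats
  -- both orders at once.
  have finish : ∀ {a b r : W} (p' : T.Walk b r) (h : T.Adj a b), (Walk.cons h p').IsPath →
      s(a, b) = s(c, d) → (∀ e ∈ (Walk.cons h p').edges, e ∈ (p₁.append (Walk.cons ‹_› p₂)).edges) →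
      f ∈ p'.edges → ∃ q y z u, s(q, y) ∈ (p₁.append (Walk.cons ‹_› p₂)).edges ∧ s(q, y) ∈ X ∧
        s(q, z) ∈ (p₁.append (Walk.cons ‹_› p₂)).edges ∧ s(q, z) ∉ X ∧
      u ∈ s(c, d) ∧ u ≠ q ∧ branch T q u = z := by
    intro a b r p' h' hp' hab hsub hfp
    obtain ⟨q, y, z, h1, h2, h3, h4, h5, h6⟩ :=
      exists_turn_of_cons X hfX p' a h' hp' (hab ▸ hgX) hfp
    have hqz : T.Adj q z := (Walk.cons h' p').edges_subset_edgeSet h3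
    refine ⟨q, y, z, a, hsub _ (by rw [Walk.edges_cons]; exact List.mem_cons_of_mem _ h1), h2,
      hsub _ h3, h4, by rw [← hab]; simp, h5, ?_⟩
    rw [branch_eq_of_reachable hT h5 hqz.ne.symm h6, branch_of_adj hT hqz]
  have hfne : f ≠ s(c, d) := fun h => hgX (h ▸ hfX)
  simp only [Walk.edges_append, Walk.edges_cons, List.mem_append, List.mem_cons] at hf
  rcases hf with hf | hf | hf
  · refine finish p₁.reverse h.symm ?_ Sym2.eq_swap ?_ (by simpa using hf)
    · rw [Walk.cons_isPath_iff]
      refine ⟨hp.of_append_left.reverse, ?_⟩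
      intro hd
      rw [Walk.support_reverse, List.mem_reverse] at hd
      have h1 := hp.support_nodup
      rw [Walk.support_append, List.nodup_append] at h1
      exact h1.2.2 d hd d (by simp) rfl
    · intro e he
      simp only [Walk.edges_cons, Walk.edges_reverse, List.mem_cons, List.mem_reverse] at he
      simp only [Walk.edges_append, Walk.edges_cons, List.mem_append, List.mem_cons]
      rcases he with rfl | he
      · right; left; exact Sym2.eq_swap
      · left; exact he
  · exact (hfne hf).elim
  · refine finish p₂ h hp.of_append_right rfl ?_ hf
    intro e he
    rw [Walk.edges_append]
    exact List.mem_append_right _ he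

end

/-! ### Every Helly representation of a gate is centred at one vertex. -/

section

theorem cycleGraph_adj_of_lt {n : ℕ} (hn : 3 ≤ n) {i j : Fin n} (hij : i.val < j.val) :
    (cycleGraph n).Adj i j ↔ j.val = i.val + 1 ∨ (i.val = 0 ∧ j.val + 1 = n) := by
  rw [cycleGraph_adj', Fin.sub_def, Fin.sub_def]
  simp only
  have h1 : (n - j.val + i.val) % n = n - j.val + i.val := Nat.mod_eq_of_lt (by omega)
  have h2 : (n - i.val + j.val) % n = j.val - i.val := by
    rw [show n - i.val + j.val = (j.val - i.val) + n by omega, Nat.add_mod_right]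
    exact Nat.mod_eq_of_lt (by omega)
  rw [h1, h2]
  omega

section attachPath

variable {U : Type u} {H : SimpleGraph U} {C C' : Set U} {l : ℕ}

theorem attachPath_adj_inl {x y : U} :
    (attachPath H C C' l).Adj (Sum.inl x) (Sum.inl y) ↔ H.Adj x y := by
  simp [attachPath]

theorem attachPath_adj_inr {i j : Fin l} :
    (attachPath H C C' l).Adj (Sum.inr i) (Sum.inr j) ↔
      i.val + 1 = j.val ∨ j.val + 1 = i.val := by
  simp [attachPath, pathGraph_adj]

theorem attachPath_adj_inl_inr {x : U} {i : Fin l} :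
    (attachPath H C C' l).Adj (Sum.inl x) (Sum.inr i) ↔
      (i.val = 0 ∧ x ∈ C) ∨ (i.val + 1 = l ∧ x ∈ C') := by
  simp [attachPath]

end attachPath

variable {V : Type u} {W : Type v} {T : SimpleGraph W}

/-- Let `q` be where the last path enters the path of vertex `0` when coming from an edge `g` shared
with its other neighbor. The remaining paths lead from one direction of the last path at `q` to the
other, so they all pass through `q` and form an ear on it. -/
theorem exists_gateOn_of_cycle (hT : T.IsTree) {G : SimpleGraph V} {s t : V → W}
    (hR : HellyRep G T s t) {n : ℕ} (hn : 4 ≤ n) (f : G ≃g cycleGraph n) :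
    ∃ q, GateOn (Uses T s t q) Set.univ := by
  have hlt : ∀ i, min i (n - 1) < n := fun i => by omega
  set e : ℕ → V := fun i => f.symm ⟨min i (n - 1), hlt i⟩ with he
  have hinj : ∀ i < n, ∀ j < n, e i = e j → i = j := by
    intro i hi j hj hij
    have := f.symm.injective hij
    simp only [Fin.mk.injEq] at this
    omega
  have hadj : ∀ i j, i < j → j < n → (G.Adj (e i) (e j) ↔ j = i + 1 ∨ (i = 0 ∧ j + 1 = n)) := by
    intro i j hij hj
    rw [he, f.symm.map_adj_iff, cycleGraph_adj_of_lt (by omega)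
      (by show min i (n - 1) < min j (n - 1); omega)]
    simp only
    rw [Nat.min_eq_left (by omega), Nat.min_eq_left (by omega)]
  have hshare : ∀ i j, i < j → j < n →
      (j = i + 1 ∨ (i = 0 ∧ j + 1 = n) ↔
        (between T (s (e i)) (t (e i)) ∩ between T (s (e j)) (t (e j))).Nonempty) := by
    intro i j hij hj
    rw [← hadj i j hij hj]
    exact hR.adj_iff _ _ (fun h => by have := hinj i (by omega) j hj h; omega)
  obtain ⟨f₀, hf₀, hf₁⟩ := (hshare 0 (n - 1) (by omega) (by omega)).1 (by omega)
  obtain ⟨g, hg₀, hg₁⟩ := (hshare (n - 1 - 1) (n - 1) (by omega) (by omega)).1 (by omega)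
  -- Vertices `0` and `n - 2` are not adjacent, because `n ≥ 4`.
  have hgX : g ∉ between T (s (e 0)) (t (e 0)) := by
    intro h
    have := (hshare 0 (n - 1 - 1) (by omega) (by omega)).2 ⟨g, h, hg₀⟩
    omega
  obtain ⟨q, y, z, u, hy, hyX, hz, hzX, hu, huq, hbr⟩ := exists_turn hT hf₁ hf₀ hg₁ hgX
  have hqy : T.Adj q y := hy.1
  have hby := branch_of_adj hT hqy
  have hyz : y ≠ z := fun h => hzX (h ▸ hyX)
  have huse : ∀ i j, i < j → j < n → ∀ w, Uses T s t q (e i) w → Uses T s t q (e j) w →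
      j = i + 1 ∨ (i = 0 ∧ j + 1 = n) :=
    fun i j hij hj w h1 h2 => (hshare i j hij hj).2 ⟨_, h1, h2⟩
  obtain ⟨b, hb0, hbl, hbinj, hleft, hright⟩ := exists_chain hT (s := s) (t := t) (q := q) (e := e)
    (l := n - 1) (by omega)
    (fun i hi => (hshare i (i + 1) (by omega) (by omega)).1 (Or.inl rfl))
    hyX (Sym2.mem_mk_right q y) hqy.ne.symm hg₀ hu huq (by rw [hbr, hby]; exact hyz)
    (by
      rw [hby]
      intro i hi hiy
      by_contra h0
      have h1 := huse 0 i (by omega) (by omega) y hyX hiy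
      have h2 := huse i (n - 1) (by omega) (by omega) y hiy hy
      omega)
    (by
      rw [hbr]
      intro i hi hiz
      by_contra h0
      have h2 := huse i (n - 1) (by omega) (by omega) z hiz hz
      have : i = 0 := by omega
      subst this
      exact hzX hiz)
    (by
      intro i hi j hj w h1 h2
      by_contra hc
      have := huse i j (by omega) (by omega) w h1 h2
      omega)
  rw [hby] at hb0
  rw [hbr] at hbl
  have hL := hR.localStar hT q
  have hE : IsEar (Uses T s t q) (points (Uses T s t q) {e (n - 1)}) b e (n - 1) :=
    { two_le := by omega
      start_mem := ⟨_, rfl, hb0 ▸ hy⟩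
      end_mem := ⟨_, rfl, hbl ▸ hz⟩
      inj := hbinj
      notMem := by
        rintro i h0 hi ⟨_, rfl, h⟩
        rcases hL.eq_or_eq hy hz h hyz with h | h
        · have := hbinj i hi.le 0 (by omega) (h.trans hb0.symm)
          omega
        · have := hbinj i hi.le (n - 1) le_rfl (h.trans hbl.symm)
          omega
      left := hleft
      right := hright }
  refine ⟨q, ?_⟩
  have := GateOn.ear hL hE
    (by rintro _ rfl; exact ⟨y, z, hyz, hy, hz⟩)
    (by
      rintro _ rfl w hw
      rw [hb0, hbl]
      exact Or.inr (hL.eq_or_eq hy hz hw hyz))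
    (by rintro _ rfl _ rfl h; exact (h rfl).elim)
  convert this
  symm
  rw [Set.eq_univ_iff_forall]
  intro v
  have hv : e (f v).val = v := by
    have : (⟨min (f v).val (n - 1), hlt _⟩ : Fin n) = f v := by
      ext; show min (f v).val (n - 1) = (f v).val; omega
    rw [he]; simp only [this, RelIso.symm_apply_apply]
  by_cases h : (f v).val = n - 1
  · left; rw [← hv, h]; rfl
  · right; exact ⟨(f v).val, by omega, hv⟩

/-- The cliques `C` and `C'` are stars of points `y` and `y'`. By the Helly property, the first and
last attached paths contain edges in these two directions, so the attached chain must cross `q` as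
an ear from `y` to `y'`. -/
theorem exists_gateOn_of_attach (hT : T.IsTree) {U : Type u} {H : SimpleGraph U} {C C' : Set U}
    {l : ℕ} (hl : 2 ≤ l) (hC : Maximal H.IsClique C) (hC' : Maximal H.IsClique C')
    (hdisj : Disjoint C C') {s t : U ⊕ Fin l → W}
    (hR : HellyRep (attachPath H C C' l) T s t) [Nonempty U] {q : W}
    (hq : GateOn (fun x => Uses T s t q (Sum.inl x)) Set.univ) :
    GateOn (Uses T s t q) Set.univ := by
  have hL := hR.localStar hT q
  have hRH : HellyRep H T (s ∘ Sum.inl) (t ∘ Sum.inl) :=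
    hR.comp ⟨⟨Sum.inl, Sum.inl_injective⟩, attachPath_adj_inl⟩
  have hLH : LocalStar H (fun x => Uses T s t q (Sum.inl x)) := hRH.localStar hT q
  obtain ⟨y, hCy⟩ := hq.exists_eq_of_maximal hLH hC
  obtain ⟨x, hx⟩ := nonempty_of_maximal_isClique hC
  obtain ⟨y', hCy'⟩ := hq.exists_eq_of_maximal hLH hC'
  obtain ⟨x', hx'⟩ := nonempty_of_maximal_isClique hC'
  have hshare : ∀ i j : Fin l, i.val < j.val →
      (between T (s (Sum.inr i)) (t (Sum.inr i)) ∩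
        between T (s (Sum.inr j)) (t (Sum.inr j))).Nonempty → j.val = i.val + 1 := by
    intro i j hij h
    rw [← hR.adj_iff _ _ (fun h => by have := Sum.inr_injective h; omega), attachPath_adj_inr] at h
    omega
  have hold : ∀ (a : U) (i : Fin l) (w : W), Uses T s t q (Sum.inl a) w →
      Uses T s t q (Sum.inr i) w → (i.val = 0 ∧ a ∈ C) ∨ (i.val + 1 = l ∧ a ∈ C') := by
    intro a i w h1 h2
    rw [← attachPath_adj_inl_inr (H := H), hR.adj_iff _ _ Sum.inl_ne_inr]
    exact ⟨_, h1, h2⟩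
  have hCC' : ∀ a, a ∈ C → a ∈ C' → False := fun a h h' => Set.disjoint_left.1 hdisj h h'
  have hedge : ∀ (D : Set U) (d : W) (i : Fin l), D = {x | Uses T s t q (Sum.inl x) d} → D.Nonempty →
      (∀ a ∈ D, (attachPath H C C' l).Adj (Sum.inl a) (Sum.inr i)) →
      ∃ g ∈ between T (s (Sum.inr i)) (t (Sum.inr i)), ∃ u ∈ g, u ≠ q ∧ branch T q u = d := by
    intro D d i hD hne hadj
    obtain ⟨g, hg⟩ := hR.helly (insert (Sum.inr i) (Sum.inl '' D)) (Set.insert_nonempty _ _) (by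
      have hc : ∀ a ∈ D, (between T (s (Sum.inl a)) (t (Sum.inl a)) ∩
          between T (s (Sum.inr i)) (t (Sum.inr i))).Nonempty :=
        fun a ha => (hR.adj_iff _ _ Sum.inl_ne_inr).1 (hadj a ha)
      rintro _ (rfl | ⟨a, ha, rfl⟩) _ (rfl | ⟨a', ha', rfl⟩) hne
      · exact (hne rfl).elim
      · rw [Set.inter_comm]; exact hc a' ha'
      · exact hc a ha
      · rw [hD] at ha ha'
        exact ⟨_, ha, ha'⟩)
    simp only [Set.mem_iInter] at hg
    have hgi := hg _ (Set.mem_insert _ _)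
    obtain ⟨u, hu, huq⟩ := exists_mem_ne_of_mem_edgeSet hgi.1 q
    refine ⟨g, hgi, u, hu, huq, ?_⟩
    -- If `g` lay in a direction other than `d`, all members at `d` would use that direction too,
    -- and two of them would be parallel.
    by_contra hbd
    obtain ⟨a, ha⟩ := hne
    have hall : ∀ a ∈ D, Uses T s t q (Sum.inl a) (branch T q u) := by
      intro a ha
      obtain ⟨w, z, hwz, hw, hz⟩ := hq.through a trivial
      exact mem_between_of_through hT hw hz hwz (hg _ (Set.mem_insert_of_mem _ ⟨a, ha, rfl⟩)) hu huq
    have had : Uses T s t q (Sum.inl a) d := by rw [hD] at ha; exact ha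
    obtain ⟨a', -, hne', ha'⟩ := hq.two a trivial d had
    refine hq.simple a trivial a' trivial hne'.symm d _ (Ne.symm hbd) had (hall a ha) ha'
      (hall a' ?_)
    rw [hD]; exact ha'
  obtain ⟨g₀, hg₀, u₀, hu₀, huq₀, hb₀⟩ := hedge C y ⟨0, by omega⟩ hCy ⟨x, hx⟩
    (fun a ha => attachPath_adj_inl_inr.2 (Or.inl ⟨rfl, ha⟩))
  obtain ⟨g₁, hg₁, u₁, hu₁, huq₁, hb₁⟩ := hedge C' y' ⟨l - 1, by omega⟩ hCy' ⟨x', hx'⟩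
    (fun a ha => attachPath_adj_inl_inr.2 (Or.inr ⟨Nat.sub_add_cancel (by omega), ha⟩))
  have hxy : Uses T s t q (Sum.inl x) y := by rw [hCy] at hx; exact hx
  have hxy' : Uses T s t q (Sum.inl x') y' := by rw [hCy'] at hx'; exact hx'
  have hyy' : y ≠ y' := by
    rintro rfl
    exact hCC' x hx (by rw [hCy', ← hCy]; exact hx)
  have hlt : ∀ i, min i (l - 1) < l := fun i => by omega
  set e : ℕ → U ⊕ Fin l := fun i => Sum.inr ⟨min i (l - 1), hlt i⟩ with he
  have hei : ∀ i (hi : i < l), e i = Sum.inr ⟨i, hi⟩ := by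
    intro i hi
    simp only [he]
    congr 2
    omega
  obtain ⟨b, hb0, hbl, hbinj, hleft, hright⟩ := exists_chain hT (s := s) (t := t) (q := q) (e := e)
    (l := l) (by omega)
    (fun i hi => by
      rw [← hR.adj_iff, hei i (by omega), hei (i + 1) hi, attachPath_adj_inr]
      · exact Or.inl rfl
      · rw [hei i (by omega), hei (i + 1) hi]
        intro h
        have := Sum.inr_injective h
        simp at this)
    (by rw [hei 0 (by omega)]; exact hg₀) hu₀ huq₀
    (by rw [hei (l - 1) (by omega)]; exact hg₁) hu₁ huq₁ (by rw [hb₀, hb₁]; exact hyy')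
    (by
      rw [hb₀]
      intro i hi h
      rw [hei i hi] at h
      rcases hold x ⟨i, hi⟩ y hxy h with h | h
      · exact h.1
      · exact (hCC' x hx h.2).elim)
    (by
      rw [hb₁]
      intro i hi h
      rw [hei i hi] at h
      rcases hold x' ⟨i, hi⟩ y' hxy' h with h | h
      · exact (hCC' x' h.2 hx').elim
      · exact h.1)
    (by
      intro i hi j hj w h1 h2
      by_contra hc
      rw [hei i hi] at h1
      rw [hei j hj] at h2
      have := hshare ⟨i, hi⟩ ⟨j, hj⟩ (by simp only; omega) ⟨_, h1, h2⟩
      simp only at this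
      omega)
  rw [hb₀] at hb0
  rw [hb₁] at hbl
  have hS := hq.range (inc := Uses T s t q) Sum.inl_injective
  have hE : IsEar (Uses T s t q) (points (Uses T s t q) (Set.range Sum.inl)) b e l :=
    { two_le := hl
      start_mem := ⟨_, ⟨x, rfl⟩, hb0 ▸ hxy⟩
      end_mem := ⟨_, ⟨x', rfl⟩, hbl ▸ hxy'⟩
      inj := hbinj
      notMem := by
        rintro i h0 hi ⟨_, ⟨a, rfl⟩, h⟩
        have h1 := hleft i hi
        have h2 := hright (i - 1) (by omega)
        rw [Nat.sub_add_cancel h0] at h2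
        rw [hei _ (by omega)] at h1 h2
        have h3 := hold a _ _ h h1
        have h4 := hold a _ _ h h2
        simp only at h3 h4
        rcases h3 with h3 | h3
        · omega
        · rcases h4 with h4 | h4
          · exact hCC' a h4.2 h3.2
          · omega
      left := hleft
      right := hright }
  have := GateOn.ear hL hE hS.through (fun v hv w hw => Or.inl (hS.two v hv w hw)) hS.simple
  convert this
  symm
  rw [Set.eq_univ_iff_forall]
  rintro (a | i)
  · exact Or.inl ⟨a, rfl⟩
  · exact Or.inr ⟨i.val, i.2, hei i.val i.2⟩

/-- Needed because the empty set is a maximal clique of the empty graph, which corresponds to no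
point. -/
theorem _root_.IsGate.nonempty {G : SimpleGraph V} (hG : IsGate G) : Nonempty V := by
  induction hG with
  | cycle G n hn e => exact ⟨e.symm ⟨0, by omega⟩⟩
  | attach H hH C C' hC hC' hdisj l hl G e ih => exact ⟨e.symm (Sum.inr ⟨0, by omega⟩)⟩

/-- In every Helly EPT representation of a gate, all paths pass through a common vertex of the
host tree. -/
theorem exists_gateOn (hT : T.IsTree) {G : SimpleGraph V} (hG : IsGate G) :
    ∀ {s t : V → W}, HellyRep G T s t → ∃ q, GateOn (Uses T s t q) Set.univ := by
  induction hG with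
  | cycle G n hn e => exact fun hR => exists_gateOn_of_cycle hT hR hn e
  | attach H hH C C' hC hC' hdisj l hl G e ih =>
    intro s t hR
    have := hH.nonempty
    have hR' := hR.comp e.symm.toEmbedding
    obtain ⟨q, hq⟩ := ih (hR'.comp ⟨⟨Sum.inl, Sum.inl_injective⟩, attachPath_adj_inl⟩)
    have h1 := exists_gateOn_of_attach hT hl hC hC' hdisj hR' hq
    refine ⟨q, ?_⟩
    have h2 : GateOn (Uses T s t q) (Set.range e.symm) := GateOn.range h1 e.symm.injective
    rwa [e.symm.surjective.range_eq] at h2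

theorem ncard_maximal_isClique_le [Finite W] (hT : T.IsTree) {G : SimpleGraph V} (hG : IsGate G)
    {s t : V → W} (hR : HellyRep G T s t) :
    ∃ q, {C : Set V | Maximal G.IsClique C}.ncard ≤ (T.neighborSet q).ncard := by
  obtain ⟨q, hq⟩ := exists_gateOn hT hG hR
  have := hG.nonempty
  refine ⟨q, ?_⟩
  rw [hq.ncard_maximal_isClique (hR.localStar hT q)]
  refine Set.ncard_le_ncard ?_ (Set.toFinite _)
  rintro y ⟨v, -, hv⟩
  exact hv.1

end

/-! ### Two-connectedness of the graph on the points, and ears. -/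

section

variable {V : Type u} {W : Type v} {G : SimpleGraph V} {inc : V → W → Prop}

/-- Two points are linked if they are incident with a common member of `X`. -/
def linkGraph (inc : V → W → Prop) (X : Set V) : SimpleGraph W where
  Adj y z := y ≠ z ∧ ∃ v ∈ X, inc v y ∧ inc v z
  symm := ⟨fun _ _ h => ⟨h.1.symm, let ⟨v, hv, h1, h2⟩ := h.2; ⟨v, hv, h2, h1⟩⟩⟩
  loopless := ⟨fun _ h => h.1 rfl⟩

theorem linkGraph_mono {X Y : Set V} (h : X ⊆ Y) : linkGraph inc X ≤ linkGraph inc Y :=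
  fun _ _ hyz => ⟨hyz.1, let ⟨v, hv, hvyz⟩ := hyz.2; ⟨v, h hv, hvyz⟩⟩

/-- No point of `N` separates two other points of `N` in the link graph. -/
def TwoConn (inc : V → W → Prop) (N : Set W) (X : Set V) : Prop :=
  ∀ a ∈ N, ∀ y ∈ N, ∀ z ∈ N, y ≠ a → z ≠ a → (avoid (linkGraph inc X) a).Reachable y z

theorem exists_walk_first_hit {H : SimpleGraph W} {K : Set W} {x z : W} (p : H.Walk x z)
    (hz : z ∈ K) : ∃ y ∈ K, ∃ r : H.Walk x y, ∀ w ∈ r.support, w ∈ K → w = y := by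
  induction p with
  | nil => exact ⟨_, hz, Walk.nil, by simp⟩
  | @cons x x' z h p ih =>
    by_cases hx : x ∈ K
    · exact ⟨x, hx, Walk.nil, by simp⟩
    · obtain ⟨y, hy, r, hr⟩ := ih hz
      refine ⟨y, hy, Walk.cons h r, ?_⟩
      simp only [Walk.support_cons, List.mem_cons]
      rintro w (rfl | hw) hwK
      · exact (hx hwK).elim
      · exact hr w hw hwK

/-- Leave `K` by some link from `y` to `x'`, then return to `K` while avoiding `y` and stop at the
first hit. Avoiding `y` makes the two ends different. -/
theorem TwoConn.exists_isEar {N K : Set W} {X : Set V} (h : TwoConn inc N X) (hKN : K ⊆ N)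
    {k₁ k₂ x : W} (hk₁ : k₁ ∈ K) (hk₂ : k₂ ∈ K) (hk : k₁ ≠ k₂) (hxN : x ∈ N) (hxK : x ∉ K)
    (hN : ∀ v y, inc v y → y ∈ N) :
    ∃ b e l, IsEar inc K b e l ∧ ∀ i < l, e i ∈ X := by
  classical
  obtain ⟨p⟩ := h k₂ (hKN hk₂) k₁ (hKN hk₁) x hxN hk (fun h => hxK (h ▸ hk₂))
  obtain ⟨⟨⟨y, x'⟩, hyx⟩, -, hyK, hxK'⟩ := p.exists_boundary_dart K hk₁ hxK
  simp only at hyK hxK'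
  replace hyx : (linkGraph inc X).Adj y x' := hyx.1
  obtain ⟨k, hkK, hky⟩ : ∃ k ∈ K, k ≠ y := by
    by_cases h : k₁ = y
    · exact ⟨k₂, hk₂, fun h' => hk (h.trans h'.symm)⟩
    · exact ⟨k₁, hk₁, h⟩
  have hx'N : x' ∈ N := by
    obtain ⟨-, v, -, -, hv⟩ := hyx
    exact hN v x' hv
  obtain ⟨p'⟩ := h y (hKN hyK) x' hx'N k (hKN hkK) hyx.1.symm hky
  obtain ⟨z, hzK, r, hr⟩ := exists_walk_first_hit p' hkK
  replace hr : ∀ w ∈ r.bypass.support, w ∈ K → w = z :=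
    fun w hw => hr w (r.support_bypass_subset_support hw)
  have hrp := r.bypass_isPath
  generalize r.bypass = r at hr hrp
  have hry : ∀ w ∈ r.support, w ≠ y := fun w hw => ne_of_mem_support_avoid r hyx.1.symm hw
  have hlen : 0 < r.length := by
    rcases Nat.eq_zero_or_pos r.length with h0 | h0
    · exact (hxK' (Walk.eq_of_length_eq_zero h0 ▸ hzK)).elim
    · exact h0
  set b : ℕ → W := fun i => if i = 0 then y else r.getVert (i - 1) with hb
  have hb0 : b 0 = y := rfl
  have hbs : ∀ i, b (i + 1) = r.getVert i := fun i => by simp [hb]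
  have hstep : ∀ i, ∃ v, i < r.length + 1 → v ∈ X ∧ inc v (b i) ∧ inc v (b (i + 1)) := by
    intro i
    by_cases hi : i < r.length + 1
    · rcases i with _ | i
      · obtain ⟨-, v, hv, h1, h2⟩ := hyx
        exact ⟨v, fun _ => ⟨hv, h1, by rw [hbs, Walk.getVert_zero]; exact h2⟩⟩
      · obtain ⟨⟨-, v, hv, h1, h2⟩, -⟩ := r.adj_getVert_succ (i := i) (by omega)
        exact ⟨v, fun _ => ⟨hv, by rw [hbs]; exact h1, by rw [hbs]; exact h2⟩⟩
    · obtain ⟨-, v, -⟩ := hyx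
      exact ⟨v, fun h => (hi h).elim⟩
  choose e he using hstep
  refine ⟨b, e, r.length + 1, ⟨by omega, hyK, ?_, ?_, ?_, fun i hi => (he i hi).2.1,
    fun i hi => (he i hi).2.2⟩, fun i hi => (he i hi).1⟩
  · rw [hbs, Walk.getVert_length]; exact hzK
  · rintro (_ | i) hi (_ | j) hj hij
    · rfl
    · rw [hb0, hbs] at hij
      exact (hry _ (r.getVert_mem_support j) hij.symm).elim
    · rw [hb0, hbs] at hij
      exact (hry _ (r.getVert_mem_support i) hij).elim
    · rw [hbs, hbs] at hij
      have := hrp.getVert_injOn (show i ≤ r.length by omega) (show j ≤ r.length by omega) hij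
      omega
  · rintro (_ | i) h0 hi
    · omega
    · rw [hbs]
      intro hK
      have h1 := hr _ (r.getVert_mem_support i) hK
      have := hrp.getVert_injOn (show i ≤ r.length by omega) (show r.length ≤ r.length by omega)
        (h1.trans r.getVert_length.symm)
      omega

namespace IsEar

variable {K : Set W} {b : ℕ → W} {e : ℕ → V} {l : ℕ}

theorem reachable (h : IsEar inc K b e l) {X : Set V} {i k : ℕ} (hik : i ≤ k) (hk : k ≤ l)
    (hX : ∀ j, i ≤ j → j < k → e j ∈ X) : (linkGraph inc X).Reachable (b i) (b k) := by
  induction k, hik using Nat.le_induction with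
  | base => exact Reachable.refl _
  | succ k hik ih =>
    refine (ih (by omega) (fun j h1 h2 => hX j h1 (by omega))).trans (Adj.reachable ⟨?_, ?_⟩)
    · intro hb
      have := h.inj k (by omega) (k + 1) hk hb
      omega
    · exact ⟨e k, hX k hik (by omega), h.left k (by omega), h.right k (by omega)⟩

theorem reachable_avoid (h : IsEar inc K b e l) {X : Set V} {a : W} (ha : ∀ i ≤ l, b i ≠ a)
    (hX : ∀ j < l, e j ∈ X) : (avoid (linkGraph inc X) a).Reachable (b 0) (b l) := by
  suffices ∀ k ≤ l, (avoid (linkGraph inc X) a).Reachable (b 0) (b k) from this l le_rfl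
  intro k
  induction k with
  | zero => intro _; exact Reachable.refl _
  | succ k ih =>
    intro hk
    refine (ih (by omega)).trans (Adj.reachable ⟨⟨?_, ?_⟩, ha k (by omega), ha _ hk⟩)
    · intro hb
      have := h.inj k (by omega) (k + 1) hk hb
      omega
    · exact ⟨e k, hX k hk, h.left k hk, h.right k hk⟩

/-- After removal of one edge of an ear, every point of it is still linked to one of its ends. -/
theorem reachable_diff (hL : LocalStar G inc) (h : IsEar inc K b e l) (w : V) {i : ℕ}
    (hi : i ≤ l) :
    (linkGraph inc ({v | ∃ i < l, e i = v} \ {w})).Reachable (b 0) (b i) ∨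
      (linkGraph inc ({v | ∃ i < l, e i = v} \ {w})).Reachable (b l) (b i) := by
  by_cases hw : ∃ j < i, e j = w
  · obtain ⟨j, hji, rfl⟩ := hw
    right
    refine (h.reachable hi le_rfl ?_).symm
    refine fun k hk hkl => ⟨⟨k, hkl, rfl⟩, fun hkj => ?_⟩
    have := h.edge_inj hL hkl (by omega) hkj
    omega
  · left
    exact h.reachable (Nat.zero_le i) hi fun k _ hk => ⟨⟨k, by omega, rfl⟩,
      fun hkw => hw ⟨k, hk, hkw⟩⟩

end IsEar

/-- No member of `S` separates two points of `S` in the link graph. -/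
def EdgeConn (inc : V → W → Prop) (S : Set V) : Prop :=
  ∀ w, ∀ y ∈ points inc S, ∀ z ∈ points inc S, (linkGraph inc (S \ {w})).Reachable y z

variable {b : ℕ → W} {e : ℕ → V} {l : ℕ} {S : Set V}

theorem IsEar.mem_points (hL : LocalStar G inc) (h : IsEar inc (points inc S) b e l) {y : W} :
    y ∈ points inc (S ∪ {v | ∃ i < l, e i = v}) ↔ y ∈ points inc S ∨ ∃ i ≤ l, y = b i := by
  constructor
  · rintro ⟨v, hv | ⟨i, hi, rfl⟩, hy⟩
    · exact Or.inl ⟨v, hv, hy⟩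
    · rcases h.eq_or_eq hL hi hy with rfl | rfl
      · exact Or.inr ⟨i, hi.le, rfl⟩
      · exact Or.inr ⟨i + 1, hi, rfl⟩
  · rintro (⟨v, hv, hy⟩ | ⟨i, hi, rfl⟩)
    · exact ⟨v, Or.inl hv, hy⟩
    · rcases hi.lt_or_eq with hi | rfl
      · exact ⟨e i, Or.inr ⟨i, hi, rfl⟩, h.left i hi⟩
      · obtain ⟨v, hv, hy⟩ := h.end_mem
        exact ⟨v, Or.inl hv, hy⟩

/-- The links between old points may use the ear: for the initial cycle, `S` is a single edge and
not itself `EdgeConn`. -/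
theorem EdgeConn.ear (hL : LocalStar G inc) (hE : IsEar inc (points inc S) b e l)
    (h : ∀ w, (∀ y ∈ points inc S, ∀ z ∈ points inc S,
        (linkGraph inc ((S ∪ {v | ∃ i < l, e i = v}) \ {w})).Reachable y z)) :
    EdgeConn inc (S ∪ {v | ∃ i < l, e i = v}) := by
  intro w
  have hsub : linkGraph inc ({v | ∃ i < l, e i = v} \ {w}) ≤
      linkGraph inc ((S ∪ {v | ∃ i < l, e i = v}) \ {w}) :=
    linkGraph_mono (Set.sdiff_subset_sdiff_left Set.subset_union_right)
  have key : ∀ y ∈ points inc (S ∪ {v | ∃ i < l, e i = v}),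
      (linkGraph inc ((S ∪ {v | ∃ i < l, e i = v}) \ {w})).Reachable (b 0) y := by
    intro y hy
    rcases (hE.mem_points hL).1 hy with hy | ⟨i, hi, rfl⟩
    · exact h w _ hE.start_mem _ hy
    · rcases hE.reachable_diff hL w hi with h' | h'
      · exact h'.mono hsub
      · exact (h w _ hE.start_mem _ hE.end_mem).trans (h'.mono hsub)
  exact fun y hy z hz => (key y hy).symm.trans (key z hz)

/-- If the ends of an ear of `S` are the points of a member `v` of `S`, then `v` is superfluous
for two-connectedness. -/
theorem TwoConn.diff_singleton {N : Set W} {X : Set V} (h : TwoConn inc N X)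
    (hL : LocalStar G inc) (hSX : S ⊆ X) (hS : EdgeConn inc S)
    (hE : IsEar inc (points inc S) b e l) (heX : ∀ i < l, e i ∈ X) {v : V} (hvS : v ∈ S)
    (hv₀ : inc v (b 0)) (hv₁ : inc v (b l)) : TwoConn inc N (X \ {v}) := by
  have hl := hE.two_le
  have hne : b 0 ≠ b l := fun h => by
    have := hE.inj 0 (by omega) l le_rfl h
    omega
  have hev : ∀ i < l, e i ∈ X \ {v} := fun i hi =>
    ⟨heX i hi, fun h => hE.notMem_edges hi (h ▸ hvS)⟩
  intro a ha y hy z hz hya hza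
  refine reachable_map id ?_ (h a ha y hy z hz hya hza)
  rintro y z ⟨⟨hyz, w, hw, hwy, hwz⟩, hya, hza⟩
  by_cases hwv : w = v
  · subst hwv
    -- The link given by the removed member is replaced by a detour: through `S` if `a` is an inner
    -- point of the ear, and along the ear if `a` is not on it.
    have hends : (avoid (linkGraph inc (X \ {w})) a).Reachable (b 0) (b l) ∨ b 0 = a ∨ b l = a := by
      by_cases hab : ∃ i ≤ l, b i = a
      · obtain ⟨i, hi, rfl⟩ := hab
        rcases Nat.eq_zero_or_pos i with rfl | h0
        · exact Or.inr (Or.inl rfl)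
        · rcases hi.lt_or_eq with hi | rfl
          · left
            have hmono : linkGraph inc (S \ {w}) ≤ avoid (linkGraph inc (X \ {w})) (b i) := by
              rintro c d ⟨hcd, x, hx, hxc, hxd⟩
              refine ⟨⟨hcd, x, ⟨hSX hx.1, hx.2⟩, hxc, hxd⟩, ?_, ?_⟩
              · rintro rfl; exact hE.notMem i h0 hi ⟨x, hx.1, hxc⟩
              · rintro rfl; exact hE.notMem i h0 hi ⟨x, hx.1, hxd⟩
            exact (hS w _ hE.start_mem _ hE.end_mem).mono hmono
          · exact Or.inr (Or.inr rfl)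
      · push Not at hab
        exact Or.inl (hE.reachable_avoid hab hev)
    have h1 := hL.eq_or_eq hv₀ hv₁ hwy hne
    have h2 := hL.eq_or_eq hv₀ hv₁ hwz hne
    rcases h1 with rfl | rfl <;> rcases h2 with rfl | rfl
    · exact (hyz rfl).elim
    · rcases hends with h | h | h
      · exact h
      · exact (hya h).elim
      · exact (hza h).elim
    · rcases hends with h | h | h
      · exact h.symm
      · exact (hza h).elim
      · exact (hya h).elim
    · exact (hyz rfl).elim
  · exact Adj.reachable ⟨⟨hyz, w, ⟨hw, hwv⟩, hwy, hwz⟩, hya, hza⟩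

end

/-! ### From ears to gates with one clique per point. -/

section

variable {V : Type u} {W : Type v} {G : SimpleGraph V} {inc : V → W → Prop}
  {b : ℕ → W} {e : ℕ → V} {l : ℕ} {S : Set V} {K : Set W}

theorem IsEar.adj_iff (hL : LocalStar G inc) (hE : IsEar inc K b e l) {i j : ℕ} (hi : i < l)
    (hj : j < l) : G.Adj (e i) (e j) ↔ i + 1 = j ∨ j + 1 = i := by
  by_cases hij : i = j
  · subst hij; simp
  rw [hL.adj_iff (fun h => hij (hE.edge_inj hL hi hj h)) (hE.through hi) (hE.through hj)]
  constructor
  · rintro ⟨y, h1, h2⟩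
    have a1 := hE.inj i hi.le j hj.le
    have a2 := hE.inj i hi.le (j + 1) hj
    have a3 := hE.inj (i + 1) hi j hj.le
    have a4 := hE.inj (i + 1) hi (j + 1) hj
    have c1 := hE.eq_or_eq hL hi h1
    have c2 := hE.eq_or_eq hL hj h2
    grind
  · rintro (rfl | rfl)
    · exact ⟨_, hE.right i hi, hE.left _ hj⟩
    · exact ⟨_, hE.left _ hi, hE.right j hj⟩

theorem IsEar.adj_old_iff (hL : LocalStar G inc) (hE : IsEar inc (points inc S) b e l)
    {v : V} (hv : v ∈ S) (hvt : Through inc v) {i : ℕ} (hi : i < l) :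
    G.Adj v (e i) ↔ (i = 0 ∧ inc v (b 0)) ∨ (i + 1 = l ∧ inc v (b l)) := by
  have hne : v ≠ e i := fun h => hE.notMem_edges hi (h ▸ hv)
  rw [hL.adj_iff hne hvt (hE.through hi)]
  constructor
  · rintro ⟨y, h1, h2⟩
    rcases hE.eq_or_eq hL hi h2 with rfl | rfl
    · left
      rcases Nat.eq_zero_or_pos i with rfl | h0
      · exact ⟨rfl, h1⟩
      · exact (hE.notMem i h0 hi ⟨v, hv, h1⟩).elim
    · right
      by_cases hil : i + 1 = l
      · exact ⟨hil, hil ▸ h1⟩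
      · exact (hE.notMem (i + 1) (by omega) (by omega) ⟨v, hv, h1⟩).elim
  · rintro (⟨rfl, h⟩ | ⟨rfl, h⟩)
    · exact ⟨_, h, hE.left 0 hi⟩
    · exact ⟨_, h, hE.right i hi⟩

/-- The ear is attached to the stars of its two ends, which are maximal cliques; `hchord` says
exactly that they are disjoint. -/
theorem isGate_of_ear (hL : LocalStar G inc) (hE : IsEar inc (points inc S) b e l)
    (hS : GateOn inc S) (hG : IsGate (G.induce S)) (hchord : ∀ v ∈ S, inc v (b 0) → ¬ inc v (b l)) :
    IsGate (G.induce (S ∪ {v | ∃ i < l, e i = v})) := by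
  have hmax : ∀ y ∈ points inc S, Maximal (G.induce S).IsClique {v : S | inc v y} := by
    rintro y ⟨v, hv, hy⟩
    exact hS.subtype.maximal_isClique (hL.induce S) ⟨⟨v, hv⟩, trivial, hy⟩
  let f : S ⊕ Fin l → ↥(S ∪ {v | ∃ i < l, e i = v}) :=
    Sum.elim (fun v => ⟨v.1, Or.inl v.2⟩) (fun i => ⟨e i, Or.inr ⟨i, i.2, rfl⟩⟩)
  have hf : Function.Bijective f := by
    constructor
    · rintro (v | i) (w | j) h
      · have h' := congrArg Subtype.val h
        exact congrArg Sum.inl (Subtype.ext h')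
      · have h' : v.1 = e j := congrArg Subtype.val h
        exact (hE.notMem_edges j.2 (h' ▸ v.2)).elim
      · have h' : e i = w.1 := congrArg Subtype.val h
        exact (hE.notMem_edges i.2 (h' ▸ w.2)).elim
      · exact congrArg Sum.inr (Fin.ext (hE.edge_inj hL i.2 j.2 (congrArg Subtype.val h)))
    · rintro ⟨v, hv | ⟨i, hi, rfl⟩⟩
      · exact ⟨Sum.inl ⟨v, hv⟩, rfl⟩
      · exact ⟨Sum.inr ⟨i, hi⟩, rfl⟩
  have hcross : ∀ (v : S) (i : Fin l), G.Adj v (e i) ↔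
      (attachPath (G.induce S) {v | inc v (b 0)} {v | inc v (b l)} l).Adj (Sum.inl v)
        (Sum.inr i) := by
    intro v i
    rw [attachPath_adj_inl_inr, hE.adj_old_iff hL v.2 (hS.through v v.2) i.2]
    rfl
  refine IsGate.attach (G.induce S) hG {v | inc v (b 0)} {v | inc v (b l)}
    (hmax _ hE.start_mem) (hmax _ hE.end_mem) ?_ l hE.two_le _ (RelIso.symm ⟨Equiv.ofBijective f hf, ?_⟩)
  · rw [Set.disjoint_left]
    exact fun v => hchord v v.2
  · rintro (v | i) (w | j)
    · rw [attachPath_adj_inl]; rfl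
    · exact hcross v j
    · rw [adj_comm, adj_comm _ (Sum.inr i)]
      exact hcross w i
    · rw [attachPath_adj_inr]
      exact hE.adj_iff hL i.2 j.2

theorem isGate_of_cycle (hL : LocalStar G inc) {v : V} (hE : IsEar inc (points inc {v}) b e l)
    (hl : 3 ≤ l) (hv₀ : inc v (b 0)) (hv₁ : inc v (b l)) :
    IsGate (G.induce ({v} ∪ {v | ∃ i < l, e i = v})) := by
  have hne : b 0 ≠ b l := fun h => by
    have := hE.inj 0 (by omega) l le_rfl h
    omega
  have hvt : Through inc v := ⟨_, _, hne, hv₀, hv₁⟩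
  let c : ℕ → V := fun i => if i < l then e i else v
  have hce : ∀ i < l, c i = e i := fun i hi => if_pos hi
  have hcl : c l = v := if_neg (lt_irrefl l)
  let f : Fin (l + 1) → ↥({v} ∪ {v | ∃ i < l, e i = v}) := fun i => ⟨c i, by
    by_cases hi : i.val < l
    · exact Or.inr ⟨i, hi, (hce i hi).symm⟩
    · exact Or.inl (if_neg hi)⟩
  have hadj : ∀ i j, i < j → j < l + 1 → (G.Adj (c i) (c j) ↔ j = i + 1 ∨ (i = 0 ∧ j + 1 = l + 1)) := by
    intro i j hij hj
    rw [hce i (by omega)]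
    rcases Nat.lt_succ_iff_lt_or_eq.1 hj with hj | rfl
    · rw [hce j hj, hE.adj_iff hL (by omega) hj]
      omega
    · rw [hcl, adj_comm, hE.adj_old_iff hL rfl hvt hij]
      constructor
      · rintro (h | h) <;> omega
      · rintro (h | h)
        · exact Or.inr ⟨h.symm, hv₁⟩
        · exact Or.inl ⟨h.1, hv₀⟩
  have hf : Function.Bijective f := by
    constructor
    · intro i j h
      replace h : c i = c j := congrArg Subtype.val h
      ext
      have hi := i.2
      have hj := j.2
      by_cases hil : i.val = l <;> by_cases hjl : j.val = l
      · omega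
      · rw [hil, hcl, hce j (by omega)] at h
        exact (hE.notMem_edges (i := j) (by omega) h.symm).elim
      · rw [hjl, hcl, hce i (by omega)] at h
        exact (hE.notMem_edges (i := i) (by omega) h).elim
      · rw [hce i (by omega), hce j (by omega)] at h
        exact hE.edge_inj hL (by omega) (by omega) h
    · rintro ⟨w, hw | ⟨i, hi, rfl⟩⟩
      · exact ⟨⟨l, by omega⟩, Subtype.ext (hcl.trans hw.symm)⟩
      · exact ⟨⟨i, by omega⟩, Subtype.ext (hce i hi)⟩
  refine IsGate.cycle _ (l + 1) (by omega) (RelIso.symm ⟨Equiv.ofBijective f hf, ?_⟩)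
  intro i j
  change G.Adj (c i) (c j) ↔ _
  rcases lt_trichotomy i.val j.val with h | h | h
  · rw [cycleGraph_adj_of_lt (by omega) h, hadj i j h j.2]
  · rw [Fin.ext h]; simp
  · rw [adj_comm, adj_comm _ i, cycleGraph_adj_of_lt (by omega) h, hadj j i h i.2]

/-- If the link graph at a vertex of the host tree is two-connected, there is a gate whose cliques
correspond to all points. -/
theorem TwoConn.exists_isKGate [Finite V] (hL : LocalStar G inc) {N : Set W} (hNfin : N.Finite)
    (hN : ∀ v y, inc v y → y ∈ N) (hcard : 3 ≤ N.ncard) (h : TwoConn inc N Set.univ) :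
    ∃ S : Set V, IsKGate N.ncard (G.induce S) := by
  -- In a minimal `X` no member is superfluous. This is what excludes members joining both ends of
  -- an ear.
  obtain ⟨X, hX⟩ := (Set.toFinite {X : Set V | TwoConn inc N X}).exists_minimal ⟨_, h⟩
  have hXt : TwoConn inc N X := hX.1
  have hmin : ∀ v ∈ X, ¬ TwoConn inc N (X \ {v}) := fun v hv hc =>
    (hX.2 hc Set.sdiff_subset hv).2 rfl
  have hbase : ∃ S ⊆ X, IsGate (G.induce S) ∧ GateOn inc S ∧ EdgeConn inc S := by
    obtain ⟨a, y, z, ha, hy, hz, hay, haz, hyz⟩ := (Set.two_lt_ncard_iff hNfin).1 hcard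
    obtain ⟨p⟩ := hXt a ha y hy z hz hay.symm haz.symm
    cases p with
    | nil => exact (hyz rfl).elim
    | @cons _ w _ hyw p =>
      obtain ⟨⟨hyw, v, hv, hvy, hvw⟩, hya, hwa⟩ := hyw
      have hpts : ∀ x, x ∈ points inc {v} ↔ x = y ∨ x = w := by
        intro x
        constructor
        · rintro ⟨_, rfl, hx⟩
          exact hL.eq_or_eq hvy hvw hx hyw
        · rintro (rfl | rfl)
          · exact ⟨v, rfl, hvy⟩
          · exact ⟨v, rfl, hvw⟩
      obtain ⟨b, e, l, hE, heX⟩ := hXt.exists_isEar (K := points inc {v})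
        (by rintro x ⟨v, -, hx⟩; exact hN v x hx) ((hpts y).2 (Or.inl rfl))
        ((hpts w).2 (Or.inr rfl)) hyw ha
        (by rw [hpts]; rintro (h | h); exacts [hay h, hwa h.symm]) hN
      have hl2 := hE.two_le
      have hne : b 0 ≠ b l := fun h => by
        have := hE.inj 0 (by omega) l le_rfl h
        omega
      obtain ⟨_, rfl, hv₀⟩ := hE.start_mem
      obtain ⟨_, rfl, hv₁⟩ := hE.end_mem
      rename_i v
      have hvt : Through inc v := ⟨_, _, hne, hv₀, hv₁⟩
      -- For `l = 2` the three members would form a triangle of points: pairwise adjacent but with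
      -- no common point, against the Helly property.
      have hl : 3 ≤ l := by
        by_contra hc
        have : l = 2 := by omega
        subst this
        have hv0 := (hE.adj_old_iff hL rfl hvt (i := 0) (by omega)).2 (Or.inl ⟨rfl, hv₀⟩)
        have hv1 := (hE.adj_old_iff hL rfl hvt (i := 1) (by omega)).2 (Or.inr ⟨rfl, hv₁⟩)
        have h01 := (hE.adj_iff hL (i := 0) (j := 1) (by omega) (by omega)).2 (Or.inl rfl)
        obtain ⟨x, hx⟩ := hL.helly {v, e 0, e 1} ⟨v, by simp⟩
          (by
            rintro _ (rfl | rfl | rfl)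
            exacts [hvt, hE.through (by omega), hE.through (by omega)])
          (by
            rintro _ (rfl | rfl | rfl) _ (rfl | rfl | rfl) hne
            exacts [(hne rfl).elim, hv0, hv1, hv0.symm, (hne rfl).elim, h01, hv1.symm, h01.symm,
              (hne rfl).elim])
        have c1 := hL.eq_or_eq hv₀ hv₁ (hx v (by simp)) hne
        have c2 := hE.eq_or_eq hL (i := 0) (by omega) (hx _ (by simp))
        have c3 := hE.eq_or_eq hL (i := 1) (by omega) (hx _ (by simp))
        have a1 := hE.inj 0 (by omega) 1 (by omega)
        have a2 := hE.inj 0 (by omega) 2 (by omega)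
        have a3 := hE.inj 1 (by omega) 2 (by omega)
        grind
      refine ⟨_, ?_, isGate_of_cycle hL hE hl hv₀ hv₁, GateOn.ear hL hE ?_ ?_ ?_,
        EdgeConn.ear hL hE ?_⟩
      · rintro _ (rfl | ⟨i, hi, rfl⟩)
        exacts [hv, heX i hi]
      · rintro _ rfl; exact hvt
      · rintro _ rfl x hx
        exact Or.inr (hL.eq_or_eq hv₀ hv₁ hx hne)
      · rintro _ rfl _ rfl h; exact (h rfl).elim
      · intro x
        have key : (linkGraph inc (({v} ∪ {v | ∃ i < l, e i = v}) \ {x})).Reachable (b 0) (b l) := by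
          by_cases hxv : v = x
          · subst hxv
            refine hE.reachable (Nat.zero_le l) le_rfl fun j _ hj => ⟨Or.inr ⟨j, hj, rfl⟩, fun h => ?_⟩
            exact hE.notMem_edges hj h
          · exact Adj.reachable ⟨hne, v, ⟨Or.inl rfl, hxv⟩, hv₀, hv₁⟩
        rintro c ⟨_, rfl, hc⟩ d ⟨_, rfl, hd⟩
        rcases hL.eq_or_eq hv₀ hv₁ hc hne with rfl | rfl <;>
          rcases hL.eq_or_eq hv₀ hv₁ hd hne with rfl | rfl
        exacts [Reachable.refl _, key, key.symm, Reachable.refl _]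
  -- Ears are added until all points are covered; each has an inner point, so the number of
  -- uncovered points drops.
  have hgrow : ∀ m, ∀ S ⊆ X, IsGate (G.induce S) → GateOn inc S → EdgeConn inc S →
      (N \ points inc S).ncard = m →
      ∃ S, IsGate (G.induce S) ∧ GateOn inc S ∧ points inc S = N := by
    intro m
    induction m using Nat.strong_induction_on with
    | _ m ih =>
      intro S hSX hSG hS hSe hm
      have hKN : points inc S ⊆ N := by rintro x ⟨v, -, hx⟩; exact hN v x hx
      by_cases hall : N ⊆ points inc S
      · exact ⟨S, hSG, hS, Set.Subset.antisymm hKN hall⟩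
      obtain ⟨x, hxN, hxK⟩ := Set.not_subset.1 hall
      obtain ⟨⟨v, hv⟩⟩ := hSG.nonempty
      obtain ⟨k₁, k₂, hk, hk₁, hk₂⟩ := hS.through v hv
      obtain ⟨b, e, l, hE, heX⟩ := hXt.exists_isEar hKN ⟨v, hv, hk₁⟩ ⟨v, hv, hk₂⟩ hk hxN hxK hN
      have hsub : S ∪ {v | ∃ i < l, e i = v} ⊆ X := by
        rintro _ (hw | ⟨i, hi, rfl⟩)
        exacts [hSX hw, heX i hi]
      -- A member of `S` joining both ends of the ear would be superfluous by
      -- `TwoConn.diff_singleton`, contradicting minimality.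
      refine ih _ ?_ (S ∪ {v | ∃ i < l, e i = v}) hsub
        (isGate_of_ear hL hE hS hSG fun w hw h0 h1 =>
          hmin w (hSX hw) (hXt.diff_singleton hL hSX hSe hE heX hw h0 h1))
        (GateOn.ear hL hE hS.through (fun v hv y hy => Or.inl (hS.two v hv y hy)) hS.simple)
        (EdgeConn.ear hL hE fun w y hy z hz => (hSe w y hy z hz).mono
          (linkGraph_mono (Set.sdiff_subset_sdiff_left Set.subset_union_left))) rfl
      rw [← hm]
      have hl2 := hE.two_le
      refine Set.ncard_lt_ncard ⟨fun z hz => ⟨hz.1, fun hzS => hz.2 ?_⟩, fun hc => ?_⟩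
        (hNfin.subset Set.sdiff_subset)
      · exact (hE.mem_points hL).2 (Or.inl hzS)
      · have hb1 : b 1 ∈ N \ points inc S :=
          ⟨hN _ _ (hE.right 0 (by omega)), hE.notMem 1 one_pos (by omega)⟩
        exact (hc hb1).2 ((hE.mem_points hL).2 (Or.inr ⟨1, by omega, rfl⟩))
  obtain ⟨S, hSX, hSG, hS, hSe⟩ := hbase
  obtain ⟨S, hSG, hS, hSN⟩ := hgrow _ S hSX hSG hS hSe rfl
  refine ⟨S, hSG, ?_⟩
  have := hSG.nonempty
  rw [hS.subtype.ncard_maximal_isClique (hL.induce S), ← hSN]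
  congr 1
  ext y
  exact ⟨fun ⟨v, _, hy⟩ => ⟨v, v.2, hy⟩, fun ⟨v, hv, hy⟩ => ⟨⟨v, hv⟩, trivial, hy⟩⟩

end

/-! ### Splitting a vertex of the host tree. -/

section

variable {V : Type u} {W : Type v} {T : SimpleGraph W} {q : W} {A : Set W}

/-- Split `q` into the adjacent vertices `some q` and `none`, where `none` takes over the
neighbors in `A`. -/
def splitVertex (T : SimpleGraph W) (q : W) (A : Set W) : SimpleGraph (Option W) where
  Adj
    | none, none => False
    | none, some w => w = q ∨ w ∈ A
    | some w, none => w = q ∨ w ∈ A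
    | some x, some y => T.Adj x y ∧ ¬ (x = q ∧ y ∈ A) ∧ ¬ (y = q ∧ x ∈ A)
  symm := ⟨by
    rintro (_ | x) (_ | y) h
    · exact h
    · exact h
    · exact h
    · exact ⟨h.1.symm, h.2.2, h.2.1⟩⟩
  loopless := ⟨by
    rintro (_ | x) h
    · exact h
    · exact h.1.ne rfl⟩

theorem splitVertex_adj_none_some {w : W} :
    (splitVertex T q A).Adj none (some w) ↔ w = q ∨ w ∈ A := Iff.rfl

theorem splitVertex_adj_some_none {w : W} :
    (splitVertex T q A).Adj (some w) none ↔ w = q ∨ w ∈ A := Iff.rfl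

theorem splitVertex_adj_some_some {x y : W} :
    (splitVertex T q A).Adj (some x) (some y) ↔
      T.Adj x y ∧ ¬ (x = q ∧ y ∈ A) ∧ ¬ (y = q ∧ x ∈ A) := Iff.rfl

theorem splitVertex_not_adj_none_none : ¬ (splitVertex T q A).Adj none none := id

/-- The contraction undoing `splitVertex`. -/
def contract (q : W) (x : Option W) : W := x.getD q

theorem adj_contract_or (hA : A ⊆ T.neighborSet q) {x y : Option W}
    (h : (splitVertex T q A).Adj x y) :
    T.Adj (contract q x) (contract q y) ∨ s(x, y) = s(none, some q) := by
  rcases x with _ | x <;> rcases y with _ | y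
  · exact (splitVertex_not_adj_none_none h).elim
  · rcases h with rfl | h
    · exact Or.inr rfl
    · exact Or.inl (hA h)
  · rcases h with rfl | h
    · exact Or.inr Sym2.eq_swap
    · exact Or.inl (hA h).symm
  · exact Or.inl h.1

theorem exists_adj_contract {x y : W} (h : T.Adj x y) :
    ∃ x' y', (splitVertex T q A).Adj x' y' ∧ contract q x' = x ∧ contract q y' = y := by
  by_cases h1 : x = q ∧ y ∈ A
  · exact ⟨none, some y, Or.inr h1.2, h1.1.symm, rfl⟩
  · by_cases h2 : y = q ∧ x ∈ A
    · exact ⟨some x, none, Or.inr h2.2, rfl, h2.1.symm⟩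
    · exact ⟨some x, some y, ⟨h, h1, h2⟩, rfl, rfl⟩

/-- Contraction is injective on the edges that it does not collapse, so old edges keep their
identity. -/
theorem eq_of_contract_eq {x y x' y' : Option W}
    (h : (splitVertex T q A).Adj x y) (h' : (splitVertex T q A).Adj x' y')
    (hx : contract q x = contract q x') (hy : contract q y = contract q y')
    (hne : contract q x ≠ contract q y) : x = x' ∧ y = y' := by
  rcases x with _ | x <;> rcases y with _ | y <;> rcases x' with _ | x' <;> rcases y' with _ | y' <;>
    simp only [contract, Option.getD_none, Option.getD_some, splitVertex_adj_none_some,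
      splitVertex_adj_some_none, splitVertex_adj_some_some, Option.some.injEq, reduceCtorEq] at * <;>
    grind

theorem reachable_contract (hA : A ⊆ T.neighborSet q) {x y : Option W}
    (h : (splitVertex T q A).Adj x y) (h' : T.Adj (contract q x) (contract q y)) {a c : Option W}
    (hr : ((splitVertex T q A).deleteEdges {s(x, y)}).Reachable a c) :
    (T.deleteEdges {s(contract q x, contract q y)}).Reachable (contract q a) (contract q c) := by
  refine reachable_map (contract q) ?_ hr
  intro x' y' hxy'
  obtain ⟨hxy, hne⟩ := deleteEdges_adj.1 hxy'
  rcases adj_contract_or hA hxy with hT | hm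
  · refine Adj.reachable (deleteEdges_adj.2 ⟨hT, fun heq => hne ?_⟩)
    rcases Sym2.eq_iff.1 heq with ⟨h1, h2⟩ | ⟨h1, h2⟩
    · obtain ⟨rfl, rfl⟩ := eq_of_contract_eq hxy h h1 h2 hT.ne
      rfl
    · obtain ⟨rfl, rfl⟩ := eq_of_contract_eq hxy h.symm h1 h2 hT.ne
      exact Sym2.eq_swap
  · rcases Sym2.eq_iff.1 hm with ⟨rfl, rfl⟩ | ⟨rfl, rfl⟩ <;> exact Reachable.refl _

theorem reachable_of_contract_eq {F : Set (Sym2 (Option W))} (hF : s(none, some q) ∉ F)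
    {a c : Option W} (h : contract q a = contract q c) :
    ((splitVertex T q A).deleteEdges F).Reachable a c := by
  have hm : ((splitVertex T q A).deleteEdges F).Adj none (some q) :=
    deleteEdges_adj.2 ⟨Or.inl rfl, hF⟩
  rcases a with _ | a <;> rcases c with _ | c <;>
    simp only [contract, Option.getD_none, Option.getD_some] at h
  · exact Reachable.refl _
  · subst h; exact hm.reachable
  · subst h; exact hm.symm.reachable
  · subst h; exact Reachable.refl _

theorem reachable_of_reachable_contract {F : Set (Sym2 (Option W))} {F' : Set (Sym2 W)}
    (hF : s(none, some q) ∉ F)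
    (hFF' : ∀ x y, s(x, y) ∈ F → s(contract q x, contract q y) ∈ F') {u w : W}
    (hr : (T.deleteEdges F').Reachable u w) : ∀ {a c : Option W}, contract q a = u →
      contract q c = w → ((splitVertex T q A).deleteEdges F).Reachable a c := by
  obtain ⟨p⟩ := hr
  induction p with
  | nil => exact fun ha hc => reachable_of_contract_eq hF (ha.trans hc.symm)
  | cons h p ih =>
    intro a c ha hc
    obtain ⟨h, hn⟩ := deleteEdges_adj.1 h
    obtain ⟨x, y, hxy, rfl, rfl⟩ := exists_adj_contract (q := q) (A := A) h
    refine (reachable_of_contract_eq hF ha).trans (Reachable.trans (Adj.reachable ?_) (ih rfl hc))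
    exact deleteEdges_adj.2 ⟨hxy, fun hF => hn (hFF' x y hF)⟩

/-- With an old edge deleted, the new edge is still present, so contracting it does not change which
vertices are connected. -/
theorem mem_between_splitVertex_iff (hA : A ⊆ T.neighborSet q) {x y : Option W}
    (h : (splitVertex T q A).Adj x y) (h' : T.Adj (contract q x) (contract q y)) (a c : Option W) :
    s(x, y) ∈ between (splitVertex T q A) a c ↔
      s(contract q x, contract q y) ∈ between T (contract q a) (contract q c) := by
  have hm : s(none, some q) ≠ s(x, y) := by
    intro hm
    rcases Sym2.eq_iff.1 hm with ⟨rfl, rfl⟩ | ⟨rfl, rfl⟩ <;> exact h'.ne rfl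
  constructor
  · rintro ⟨-, hn⟩
    refine ⟨h', fun hr => hn (reachable_of_reachable_contract hm ?_ hr rfl rfl)⟩
    intro x' y' hF
    rcases Sym2.eq_iff.1 hF with ⟨rfl, rfl⟩ | ⟨rfl, rfl⟩
    · rfl
    · exact Sym2.eq_swap
  · rintro ⟨-, hn⟩
    refine ⟨h, fun hr => ?_⟩
    have hr' := reachable_contract hA h h' hr
    exact absurd hr' hn

/-- The vertices on the side of `none` of the edge between `none` and `some q`. -/
def NewSide (T : SimpleGraph W) (q : W) (A : Set W) : Option W → Prop
  | none => True
  | some w => w ≠ q ∧ branch T q w ∈ A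

/-- The side is invariant along every other edge, which makes the new edge a bridge. -/
theorem newSide_iff (hT : T.IsTree) (hA : A ⊆ T.neighborSet q) {x y : Option W}
    (h : (splitVertex T q A).Adj x y) (hm : s(x, y) ≠ s(none, some q)) :
    NewSide T q A x ↔ NewSide T q A y := by
  have hnone : ∀ w, w ∈ A → NewSide T q A (some w) := fun w hw =>
    ⟨(hA hw).ne.symm, by rw [branch_of_adj hT (hA hw)]; exact hw⟩
  have hqside : ¬ NewSide T q A (some q) := fun h => h.1 rfl
  rcases x with _ | x <;> rcases y with _ | y
  · exact Iff.rfl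
  · rcases h with rfl | h
    · exact (hm rfl).elim
    · exact iff_of_true trivial (hnone y h)
  · rcases h with rfl | h
    · exact (hm Sym2.eq_swap).elim
    · exact iff_of_true (hnone x h) trivial
  · obtain ⟨h, h1, h2⟩ := h
    by_cases hx : x = q
    · subst hx
      refine iff_of_false hqside fun hy => h1 ⟨rfl, ?_⟩
      rw [← branch_of_adj hT h]; exact hy.2
    · by_cases hy : y = q
      · subst hy
        refine iff_of_false (fun hx => h2 ⟨rfl, ?_⟩) hqside
        rw [← branch_of_adj hT h.symm]; exact hx.2
      · simp only [NewSide, ne_eq, hx, hy, branch_eq_of_adj hT hx hy h]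

theorem isTree_splitVertex (hT : T.IsTree) (hA : A ⊆ T.neighborSet q) :
    (splitVertex T q A).IsTree := by
  have : Nonempty (Option W) := ⟨none⟩
  refine ⟨⟨fun a c => ?_⟩, ?_⟩
  · have h1 : (T.deleteEdges ∅).Reachable (contract q a) (contract q c) := by
      rw [deleteEdges_empty]; exact hT.connected.preconnected _ _
    have := reachable_of_reachable_contract (T := T) (q := q) (A := A) (F := ∅) (F' := ∅) (by simp)
      (by simp) h1 (a := a) (c := c) rfl rfl
    rwa [deleteEdges_empty] at this
  · rw [isAcyclic_iff_forall_adj_isBridge]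
    intro x y hxy
    rw [isBridge_iff]
    intro hr
    by_cases hm : s(x, y) = s(none, some q)
    · rw [hm] at hr
      have key : ∀ x y, ((splitVertex T q A).deleteEdges {s(none, some q)}).Adj x y →
          (NewSide T q A x ↔ NewSide T q A y) := by
        intro x y h
        obtain ⟨h, hne⟩ := deleteEdges_adj.1 h
        exact newSide_iff hT hA h hne
      have := iff_of_reachable key hr
      rcases Sym2.eq_iff.1 hm with ⟨rfl, rfl⟩ | ⟨rfl, rfl⟩
      · exact (this.1 trivial).1 rfl
      · exact (this.2 trivial).1 rfl
    · have h' := (adj_contract_or hA hxy).resolve_right hm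
      have := reachable_contract hA hxy h' hr
      have hb := isAcyclic_iff_forall_adj_isBridge.1 hT.isAcyclic h'
      rw [isBridge_iff] at hb
      exact hb this

theorem reachable_side (hT : T.IsTree) (hA : A ⊆ T.neighborSet q) (x : Option W) :
    (NewSide T q A x →
      ((splitVertex T q A).deleteEdges {s(none, some q)}).Reachable none x) ∧
    (¬ NewSide T q A x →
      ((splitVertex T q A).deleteEdges {s(none, some q)}).Reachable (some q) x) := by
  rcases x with _ | w
  · exact ⟨fun _ => Reachable.refl _, fun h => (h trivial).elim⟩
  by_cases hw : w = q
  · subst hw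
    exact ⟨fun h => (h.1 rfl).elim, fun _ => Reachable.refl _⟩
  obtain ⟨h1, h2⟩ := branch_spec hT hw
  have h3 : ((splitVertex T q A).deleteEdges {s(none, some q)}).Reachable
      (some (branch T q w)) (some w) := by
    refine reachable_map some ?_ h2
    rintro x y ⟨hxy, hx, hy⟩
    exact Adj.reachable (deleteEdges_adj.2 ⟨⟨hxy, fun h => hx h.1, fun h => hy h.1⟩, by simp⟩)
  constructor
  · rintro ⟨-, hb⟩
    refine Reachable.trans (Adj.reachable (deleteEdges_adj.2
      ⟨splitVertex_adj_none_some.2 (Or.inr hb), ?_⟩)) h3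
    simp [h1.ne.symm]
  · intro hb
    have hb' : branch T q w ∉ A := fun h => hb ⟨hw, h⟩
    refine Reachable.trans (Adj.reachable (deleteEdges_adj.2
      ⟨splitVertex_adj_some_some.2 ⟨h1, fun h => hb' h.2, ?_⟩, ?_⟩)) h3
    · exact fun h => h1.ne h.1.symm
    · simp

open Classical in
/-- The end `x` of a path to `z` after splitting `q`. -/
noncomputable def splitEnd (T : SimpleGraph W) (q : W) (A : Set W) (x z : W) : Option W :=
  -- A path starting at `q` towards `A` must start at `none`, as otherwise it would use the new edge
  -- without passing through `q` before.
  if x = q ∧ branch T q z ∈ A then none else some x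

theorem contract_splitEnd (x z : W) : contract q (splitEnd T q A x z) = x := by
  unfold splitEnd
  split_ifs with h
  · exact h.1.symm
  · rfl

/-- A path that uses the new edge comes from a path which passes through `q` and uses an edge to
`A` and an edge to another neighbor. -/
theorem exists_of_newEdge_mem (hT : T.IsTree) (hA : A ⊆ T.neighborSet q) {x z : W}
    (h : s(none, some q) ∈ between (splitVertex T q A) (splitEnd T q A x z) (splitEnd T q A z x)) :
    ∃ y ∈ A, ∃ y' ∉ A, s(q, y) ∈ between T x z ∧ s(q, y') ∈ between T x z := by
  have hqA : q ∉ A := fun h => (hA h).ne rfl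
  have main : ∀ {x z : W}, NewSide T q A (splitEnd T q A x z) →
      ¬ NewSide T q A (splitEnd T q A z x) →
      ∃ y ∈ A, ∃ y' ∉ A, s(q, y) ∈ between T x z ∧ s(q, y') ∈ between T x z := by
    intro x z hx hz
    have hzq : ¬ (z = q ∧ branch T q x ∈ A) := by
      intro hc
      rw [splitEnd, if_pos hc] at hz
      exact hz trivial
    rw [splitEnd, if_neg hzq] at hz
    by_cases hxq : x = q ∧ branch T q z ∈ A
    · refine (hz ⟨?_, hxq.2⟩).elim
      rintro rfl
      rw [branch_self hT] at hxq
      exact hqA hxq.2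
    · rw [splitEnd, if_neg hxq] at hx
      obtain ⟨hx, hxA⟩ := hx
      have hzne : z ≠ q := fun h => hzq ⟨h, hxA⟩
      have hzA : branch T q z ∉ A := fun h => hz ⟨hzne, h⟩
      have hne : branch T q x ≠ branch T q z := fun h => hzA (h ▸ hxA)
      refine ⟨_, hxA, _, hzA, ?_, ?_⟩
      · rw [mem_between_iff hT (branch_spec hT hx).1]
        exact fun h => hne (h.1 rfl).symm
      · rw [mem_between_iff hT (branch_spec hT hzne).1]
        exact fun h => hne (h.2 rfl)
  by_cases h1 : NewSide T q A (splitEnd T q A x z) <;>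
    by_cases h2 : NewSide T q A (splitEnd T q A z x)
  · exact (h.2 (((reachable_side hT hA _).1 h1).symm.trans ((reachable_side hT hA _).1 h2))).elim
  · exact main h1 h2
  · rw [between_comm]; exact main h2 h1
  · exact (h.2 (((reachable_side hT hA _).2 h1).symm.trans ((reachable_side hT hA _).2 h2))).elim

/-- Splitting a vertex preserves a Helly representation if all paths which use an edge to `A` and
another edge at `q` have a common edge at `q`. -/
theorem HellyRep.splitVertex {G : SimpleGraph V} {s t : V → W} (hT : T.IsTree)
    (h : HellyRep G T s t) (hA : A ⊆ T.neighborSet q) (a : W)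
    (ha : ∀ v, ∀ y ∈ A, ∀ y' ∉ A, Uses T s t q v y → Uses T s t q v y' → Uses T s t q v a) :
    HellyRep G (splitVertex T q A) (fun v => splitEnd T q A (s v) (t v))
      (fun v => splitEnd T q A (t v) (s v)) := by
  set P' : V → Set (Sym2 (Option W)) := fun v => between (HellyEPT.splitVertex T q A)
    (splitEnd T q A (s v) (t v)) (splitEnd T q A (t v) (s v)) with hP'
  have hup : ∀ g ∈ T.edgeSet, ∃ g', ∀ v, g ∈ between T (s v) (t v) → g' ∈ P' v := by
    intro g hg
    induction g with
    | h x y =>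
      obtain ⟨x', y', hxy, rfl, rfl⟩ := exists_adj_contract (q := q) (A := A) hg
      refine ⟨s(x', y'), fun v hv => ?_⟩
      rw [hP']
      rw [mem_between_splitVertex_iff hA hxy hg, contract_splitEnd, contract_splitEnd]
      exact hv
  have hdown : ∀ g', g' ∈ (HellyEPT.splitVertex T q A).edgeSet →
      ∃ g, ∀ v, g' ∈ P' v → g ∈ between T (s v) (t v) := by
    intro g' hg'
    induction g' with
    | h x y =>
      rcases adj_contract_or hA hg' with hxy | hm
      · refine ⟨s(contract q x, contract q y), fun v hv => ?_⟩
        rw [hP'] at hv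
        rw [mem_between_splitVertex_iff hA hg' hxy, contract_splitEnd, contract_splitEnd] at hv
        exact hv
      -- Paths over the new edge join `A` to another neighbor, so they all used the edge from `q` to
      -- `a` already.
      · refine ⟨s(q, a), fun v hv => ?_⟩
        rw [hm] at hv
        obtain ⟨y, hy, y', hy', h1, h2⟩ := exists_of_newEdge_mem hT hA hv
        exact ha v y hy y' hy' h1 h2
  have hiff : ∀ v w, (P' v ∩ P' w).Nonempty ↔
      (between T (s v) (t v) ∩ between T (s w) (t w)).Nonempty := by
    intro v w
    constructor
    · rintro ⟨g', h1, h2⟩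
      obtain ⟨g, hg⟩ := hdown g' h1.1
      exact ⟨g, hg v h1, hg w h2⟩
    · rintro ⟨g, h1, h2⟩
      obtain ⟨g', hg⟩ := hup g h1.1
      exact ⟨g', hg v h1, hg w h2⟩
  refine ⟨fun x y hxy => (h.adj_iff x y hxy).trans (hiff x y).symm, fun I hI hp => ?_⟩
  obtain ⟨g, hg⟩ := h.helly I hI (fun v hv w hw hne => (hiff v w).1 (hp hv hw hne))
  simp only [Set.mem_iInter] at hg
  obtain ⟨v, hv⟩ := hI
  obtain ⟨g', hg'⟩ := hup g (hg v hv).1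
  refine ⟨g', ?_⟩
  simp only [Set.mem_iInter]
  exact fun w hw => hg' w (hg w hw)

theorem ncard_neighborSet_none [Finite W] (hA : A ⊆ T.neighborSet q) :
    ((splitVertex T q A).neighborSet none).ncard = A.ncard + 1 := by
  have hqA : q ∉ A := fun h => (hA h).ne rfl
  have : (splitVertex T q A).neighborSet none = some '' (insert q A) := by
    ext (_ | w)
    · simp [mem_neighborSet]
    · simp [mem_neighborSet, splitVertex_adj_none_some]
  rw [this, Set.ncard_image_of_injective _ (Option.some_injective W),
    Set.ncard_insert_of_notMem hqA (Set.toFinite _)]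

theorem ncard_neighborSet_some_self [Finite W] (hA : A ⊆ T.neighborSet q) :
    ((splitVertex T q A).neighborSet (some q)).ncard = (T.neighborSet q \ A).ncard + 1 := by
  have hqA : q ∉ A := fun h => (hA h).ne rfl
  have : (splitVertex T q A).neighborSet (some q) =
      insert none (some '' (T.neighborSet q \ A)) := by
    ext (_ | w)
    · simp [mem_neighborSet, splitVertex_adj_some_none]
    · simp only [mem_neighborSet, splitVertex_adj_some_some, Set.mem_insert_iff, reduceCtorEq,
        false_or, Set.mem_image, Option.some.injEq, exists_eq_right, Set.mem_sdiff]
      grind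
  rw [this, Set.ncard_insert_of_notMem (by simp) (Set.toFinite _),
    Set.ncard_image_of_injective _ (Option.some_injective W)]

theorem ncard_neighborSet_some (hA : A ⊆ T.neighborSet q) {w : W} (hw : w ≠ q) :
    ((splitVertex T q A).neighborSet (some w)).ncard = (T.neighborSet w).ncard := by
  classical
  have : (splitVertex T q A).neighborSet (some w) =
      (fun x => if x = q ∧ w ∈ A then none else some x) '' T.neighborSet w := by
    have hqw : w ∈ A → T.Adj w q := fun h => (hA h).symm
    ext (_ | x)
    · simp only [mem_neighborSet, splitVertex_adj_some_none, hw, false_or, Set.mem_image]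
      constructor
      · exact fun h => ⟨q, hqw h, if_pos ⟨rfl, h⟩⟩
      · rintro ⟨x, -, hx⟩
        by_contra hc
        simp [hc] at hx
    · simp only [mem_neighborSet, splitVertex_adj_some_some, hw, false_and, not_false_eq_true,
        true_and, Set.mem_image]
      constructor
      · rintro ⟨h1, h2⟩
        exact ⟨x, h1, if_neg h2⟩
      · rintro ⟨y, hy, h⟩
        split_ifs at h with hc
        simp only [Option.some.injEq] at h
        subst h
        exact ⟨hy, hc⟩
  rw [this]
  apply Set.InjOn.ncard_image
  intro x _ y _ h
  grind

end

/-! ### Adjusting the degrees of the host tree. -/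

section

variable {V : Type u} {G : SimpleGraph V}

/-- A vertex of degree at least four whose link graph is not two-connected can be split. -/
theorem exists_split {W : Type v} [Finite W] {T : SimpleGraph W} {s t : V → W} {q : W}
    (hq : 4 ≤ (T.neighborSet q).ncard)
    (hn : ¬ TwoConn (Uses T s t q) (T.neighborSet q) Set.univ) :
    ∃ A ⊆ T.neighborSet q, ∃ a,
      (∀ v, ∀ y ∈ A, ∀ y' ∉ A, Uses T s t q v y → Uses T s t q v y' → Uses T s t q v a) ∧
      2 ≤ A.ncard ∧ 2 ≤ (T.neighborSet q \ A).ncard := by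
  set N := T.neighborSet q with hN
  simp only [TwoConn, not_forall] at hn
  obtain ⟨a, haN, y, hyN, z, hzN, hya, hza, hr⟩ := hn
  set L := avoid (linkGraph (Uses T s t q) Set.univ) a
  have hadj : ∀ v x x', Uses T s t q v x → Uses T s t q v x' → x ≠ a → x' ≠ a →
      L.Reachable x x' := by
    intro v x x' hx hx' hxa hxa'
    by_cases h : x = x'
    · rw [h]
    · exact Adj.reachable ⟨⟨h, v, trivial, hx, hx'⟩, hxa, hxa'⟩
  have huse : ∀ v x, Uses T s t q v x → x ∈ N := fun v x h => h.1
  set B := {x | x ∈ N ∧ x ≠ a ∧ L.Reachable y x} with hB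
  set C := {x | x ∈ N ∧ x ≠ a ∧ ¬ L.Reachable y x} with hC
  have hcross : ∀ v, ∀ x ∈ N, ∀ x' ∈ N, Uses T s t q v x → Uses T s t q v x' →
      x ≠ a → x' ≠ a → (L.Reachable y x ↔ L.Reachable y x') :=
    fun v x _ x' _ hx hx' hxa hxa' =>
      ⟨fun h => h.trans (hadj v x x' hx hx' hxa hxa'),
        fun h => h.trans (hadj v x x' hx hx' hxa hxa').symm⟩
  have hyB : y ∈ B := ⟨hyN, hya, Reachable.refl _⟩
  have hzC : z ∈ C := ⟨hzN, hza, hr⟩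
  have haB : a ∉ B := fun h => h.2.1 rfl
  have haC : a ∉ C := fun h => h.2.1 rfl
  have hBC : B ∪ C = N \ {a} := by
    ext x
    simp only [hB, hC, Set.mem_union, Set.mem_ofPred_eq, Set.mem_sdiff, Set.mem_singleton_iff]
    tauto
  -- `B` and `C` partition the at least three neighbors other than `a`, so one of them has two
  -- elements and serves as `A`. Its complement contains `a` and an element of the other part.
  have hcard : 3 ≤ B.ncard + C.ncard := by
    have h1 := Set.ncard_union_le B C
    rw [hBC, Set.ncard_sdiff_singleton_of_mem haN] at h1
    omega
  have htwo : ∀ D, a ∉ D → ∀ x ∈ N, x ≠ a → x ∉ D → 2 ≤ (N \ D).ncard := by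
    intro D haD x hxN hxa hxD
    exact (Set.one_lt_ncard (Set.toFinite _)).2 ⟨a, ⟨haN, haD⟩, x, ⟨hxN, hxD⟩, hxa.symm⟩
  by_cases hB2 : 2 ≤ B.ncard
  · refine ⟨B, fun x hx => hx.1, a, ?_, hB2, htwo B haB z hzN hza fun h => hr h.2.2⟩
    intro v x hx x' hx' h1 h2
    by_cases h : x' = a
    · rwa [← h]
    · exact (hx' ⟨huse v x' h2, h,
        (hcross v x hx.1 x' (huse v x' h2) h1 h2 hx.2.1 h).1 hx.2.2⟩).elim
  · refine ⟨C, fun x hx => hx.1, a, ?_, by omega,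
      htwo C haC y hyN hya fun h => h.2.2 (Reachable.refl _)⟩
    intro v x hx x' hx' h1 h2
    by_cases h : x' = a
    · rwa [← h]
    · exact (hx' ⟨huse v x' h2, h,
        fun h' => hx.2.2 ((hcross v x hx.1 x' (huse v x' h2) h1 h2 hx.2.1 h).2 h')⟩).elim

/-- Splitting vertices reduces all degrees to at most `h` if there are no large gates. -/
theorem exists_hellyRep_ncard_le [Finite V] {h : ℕ} (hh : 3 ≤ h)
    (hgate : ¬ ∃ k : ℕ, h < k ∧ ∃ S : Set V, IsKGate k (G.induce S)) (m : ℕ) :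
    ∀ (W : Type) [Fintype W] (T : SimpleGraph W) (s t : V → W), T.IsTree → HellyRep G T s t →
      ∑ w, ((T.neighborSet w).ncard - 3) = m →
      ∃ (W : Type) (_ : Fintype W) (T : SimpleGraph W) (s t : V → W), T.IsTree ∧
        HellyRep G T s t ∧ ∀ w, (T.neighborSet w).ncard ≤ h := by
  classical
  induction m using Nat.strong_induction_on with
  | _ m ih =>
    intro W _ T s t hT hR hm
    by_cases hall : ∀ w, (T.neighborSet w).ncard ≤ h
    · exact ⟨W, inferInstance, T, s, t, hT, hR, hall⟩
    push Not at hall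
    obtain ⟨q, hq⟩ := hall
    have hn : ¬ TwoConn (Uses T s t q) (T.neighborSet q) Set.univ := fun hc =>
      hgate ⟨_, hq, hc.exists_isKGate (hR.localStar hT q) (Set.toFinite _)
        (fun v y hv => hv.1) (by omega)⟩
    obtain ⟨A, hA, a, ha, hA2, hA2'⟩ := exists_split (by omega) hn
    refine ih _ ?_ (Option W) (splitVertex T q A) _ _ (isTree_splitVertex hT hA)
      (hR.splitVertex hT hA a ha) rfl
    have hd : (T.neighborSet q \ A).ncard + A.ncard = (T.neighborSet q).ncard :=
      Set.ncard_sdiff_add_ncard_of_subset hA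
    -- Degree `d` is replaced by `|A| + 1` and `d - |A| + 1`, both at least `3`. Their contributions
    -- to the sum add up to `d - 4`, one less than before; other degrees are unchanged.
    rw [← hm, Fintype.sum_option, ncard_neighborSet_none hA,
      ← Finset.add_sum_erase _ _ (Finset.mem_univ q),
      ← Finset.add_sum_erase _ (fun w => (T.neighborSet w).ncard - 3) (Finset.mem_univ q),
      ncard_neighborSet_some_self hA,
      Finset.sum_congr rfl (fun w hw => by
        rw [ncard_neighborSet_some hA (Finset.ne_of_mem_erase hw)])]
    omega

/-- Adding leaves at a vertex increases its degree to `h`. -/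
theorem exists_hellyRep_ncard_eq {h : ℕ} (hh : 1 ≤ h) (n : ℕ) :
    ∀ (W : Type) [Fintype W] (T : SimpleGraph W) (s t : V → W) (q : W), T.IsTree →
      HellyRep G T s t → (∀ w, (T.neighborSet w).ncard ≤ h) → (T.neighborSet q).ncard + n = h →
      ∃ (W : Type) (_ : Fintype W) (T : SimpleGraph W) (s t : V → W), T.IsTree ∧
        HellyRep G T s t ∧ (∀ w, (T.neighborSet w).ncard ≤ h) ∧
        ∃ w, (T.neighborSet w).ncard = h := by
  induction n with
  | zero => exact fun W _ T s t q hT hR hle hq => ⟨W, inferInstance, T, s, t, hT, hR, hle, q, hq⟩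
  | succ n ih =>
    intro W _ T s t q hT hR hle hq
    have hA : ∅ ⊆ T.neighborSet q := Set.empty_subset _
    have hself := ncard_neighborSet_some_self hA
    rw [Set.sdiff_empty] at hself
    -- Splitting along the empty set attaches the leaf `none` to `q`; the condition on crossing
    -- paths is then vacuous.
    refine ih (Option W) (splitVertex T q ∅) _ _ (some q) (isTree_splitVertex hT hA)
      (hR.splitVertex hT hA q fun _ _ hy => hy.elim) ?_ (by omega)
    rintro (_ | w)
    · rw [ncard_neighborSet_none hA, Set.ncard_empty]
      omega
    · by_cases hw : w = q
      · subst hw; omega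
      · rw [ncard_neighborSet_some hA hw]
        exact hle w

theorem ncard_neighborSet_eq_degree {W : Type v} (T : SimpleGraph W) (w : W)
    [Fintype (T.neighborSet w)] : (T.neighborSet w).ncard = T.degree w := by
  rw [Set.ncard_eq_toFinset_card', degree, neighborFinset]

end

end HellyEPT

open HellyEPT

theorem theorem3 {V : Type u} [Finite V] (G : SimpleGraph V) (hG : IsHellyEPT G)
    (h : ℕ) (hh : 3 ≤ h) :
    ¬ IsHellyEPTOfMaxDegree G h ↔
      ∃ k : ℕ, h < k ∧ ∃ S : Set V, IsKGate k (G.induce S) := by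
  classical
  constructor
  · intro hn
    by_contra hgate
    obtain ⟨W, _, T, hT, R, hR⟩ := hG
    obtain ⟨W, _, T, s, t, hT, hR, hle⟩ :=
      exists_hellyRep_ncard_le hh hgate _ W T _ _ hT (hellyRep_of_isHelly hT R hR) rfl
    obtain ⟨q⟩ := hT.nonempty
    -- The maximum degree must equal `h`, so the missing degree at an arbitrary vertex is filled up
    -- with leaves.
    obtain ⟨W, _, T, s, t, hT, hR, hle, q, hq⟩ := exists_hellyRep_ncard_eq (h := h) (by omega)
      (h - (T.neighborSet q).ncard) W T s t q hT hR hle (by have := hle q; omega)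
    refine hn ⟨W, inferInstance, T, hT, le_antisymm ?_ ?_, exists_isHelly_of_hellyRep hT hR⟩
    · refine SimpleGraph.maxDegree_le_of_forall_degree_le T h fun w => ?_
      rw [← ncard_neighborSet_eq_degree]
      exact hle w
    · rw [← hq, ncard_neighborSet_eq_degree]
      exact T.degree_le_maxDegree q
  · rintro ⟨k, hk, S, hS, hcard⟩ ⟨W, _, T, hT, hdeg, R, hR⟩
    obtain ⟨q, hq⟩ := ncard_maximal_isClique_le hT hS
      ((hellyRep_of_isHelly hT R hR).comp (SimpleGraph.Embedding.induce S))
    rw [hcard, ncard_neighborSet_eq_degree] at hq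
    have := T.degree_le_maxDegree q
    omega
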